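/- Let $p>3$ be a prime, let $H_k=\sum_{j=1}^{k}\frac1j$ (so $H_0=0$), let $q_p(2)=\frac{2^{p-1}-1}{p}$ be the Fermat quotient, and let $\Gamma_p:\mathbb{Z}_p\to\mathbb{Z}_p$ be Morita's $p$-adic Gamma function, i.e. the continuous extension to $\mathbb{Z}_p$ of the sequence $n\mapsto(-1)^n\prod_{0\le k<n,\ \gcd(k,p)=1}k$ (where $n>1$). For $a,b\in\mathbb{Q}_p$ write $a\equiv b\pmod{p^2}$ if $a-b\in p^2\mathbb{Z}_p$. Then $$\sum_{k=0}^{p-1}\frac{\binom{2k}{k}^3}{64^k}\bigl(2-3(4k+1)H_k\bigr)(-1)^k\equiv(-1)^{\frac{p-1}{2}}\bigl(2+6p\,q_p(2)\bigr)\pmod{p^2},$$ $$\sum_{k=0}^{p-1}\frac{\binom{2k}{k}^4}{256^k}\bigl(2-4(4k+1)H_k\bigr)\equiv 2+12p\,q_p(2)\pmod{p^2},$$ $$\sum_{k=0}^{p-1}\frac{\binom{2k}{k}^5}{1024^k}\bigl(2-5(4k+1)H_k\bigr)(-1)^k\equiv\begin{cases}-\bigl(2+10p\,q_p(2)\bigr)\,\Gamma_p\!\left(\tfrac14\right)^4&\text{if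 }p\equiv1\pmod 4,\\[2mm] 0&\text{if }p\equiv3\pmod 4,\end{cases}\pmod{p^2}.$$ -/

import Mathlib

open Filter Topology

noncomputable section

/-- The Fermat quotient `q_p(a) = (a ^ (p - 1) - 1) / p`, as a rational number. -/
def fermatQuotient (p a : ℕ) : ℚ := ((a : ℚ) ^ (p - 1) - 1) / p

/-- The sequence `n ↦ (-1) ^ n * ∏ k`, the product over `0 ≤ k < n` with `k` prime to `p`,
which Morita's `p`-adic Gamma function interpolates. -/
def moritaSeq (p : ℕ) [Fact p.Prime] (n : ℕ) : ℤ_[p] :=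
  (-1) ^ n * ∏ k ∈ (Finset.range n).filter (fun k => Nat.Coprime k p), (k : ℤ_[p])

/-- Morita's `p`-adic Gamma function `Γ_p : ℤ_p → ℤ_p` (for an odd prime `p`): the extension by
continuity of `moritaSeq p`, i.e. `Γ_p(x)` is the limit of `moritaSeq p n` as the natural number
`n` tends to `x` in the `p`-adic topology. -/
def padicGamma (p : ℕ) [Fact p.Prime] (x : ℤ_[p]) : ℤ_[p] :=
  limUnder (comap (fun n : ℕ => (n : ℤ_[p])) (𝓝 x)) (moritaSeq p)

/-- `a ≡ b (mod p ^ n)` for `p`-adic numbers: `a - b` lies in `p ^ n ℤ_p`. For rational numbers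
this says that `a - b` is `p ^ n` times a rational number whose denominator is prime to `p`. -/
def PadicModEq (p : ℕ) [Fact p.Prime] (n : ℕ) (a b : ℚ_[p]) : Prop :=
  ∃ z : ℤ_[p], a - b = (p : ℚ_[p]) ^ n * (z : ℚ_[p])

end

/-! Write p = 2n + 1 and (x)_k for the rising factorial, so that C(2k,k)/4^k = (1/2)_k/(1)_k.
Harmonic numbers are first-order coefficients: (1 + tp)_k = k! (1 + tp H_k + O(p²)). Hence, with m +
2 the exponent of the binomial coefficient, p times the k-th summand (k ≤ n) is modulo p³ twice a
difference of k-th terms of two very-well-poised series, one with a = n + 1 = (1 + p)/2 and one with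
a = -n = (1 - p)/2. Apart from the common factor (-n)_k (n + 1)_k ≡ (1/2)_k² (mod p²), the two terms
are exchanged by p ↦ -p, so even orders cancel (`summand_modEq`).

The series with a = -n is antisymmetric under k ↦ n - k and vanishes (`sum_wellPoised_antisymm`);
summands with n < k < p vanish modulo p². So p times the sum in question is twice the series W with
a = n + 1, modulo p³ (`harmonic_sum_modEq`). It terminates because of the parameter -n, and its
exact evaluation contains the factor p = 2n + 1, which is cancelled to leave a congruence modulo p².

For m = 1 and m = 2, W is a summable ₄F₃(-1) or ₅F₄(1), equal to p Q and p Q² with Q = `halfQuot`.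
Reversal, duplication and (1 + tp)_{p-1} ≡ (p - 1)! (mod p²) give Q ≡ (-1)^n (4^n)³, and 4^n =
2^(p-1) = 1 + p q_p(2).

For m = 3, Whipple's transformation gives W = p Q times a ₃F₂(1). Modulo p² such a term only sees
the total of the shifts by multiples of p in its numerator and the total in its denominator, so the
parameters can be moved until Dixon's theorem applies (`sum_modEq_dixonQuot`). The Dixon value
carries two factors p when p ≡ 3 (mod 4). When p = 4m + 1 it is (4^n)² (p - 1)!/(1 - p/4)_m⁴;
Wilson's theorem modulo p^k gives control of Γ_p(1/4), and the value becomes -(4^n)² Γ_p(1/4)⁴. -/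

/-- The rising factorial `x (x + 1) ⋯ (x + k - 1)`. -/
def poch {R : Type*} [CommRing R] (x : R) (k : ℕ) : R := ∏ i ∈ Finset.range k, (x + i)

/-! ### Rising factorials -/

section Poch

variable {R : Type*} [CommRing R]

@[simp] lemma poch_zero (x : R) : poch x 0 = 1 := by simp [poch]

lemma poch_succ (x : R) (k : ℕ) : poch x (k + 1) = poch x k * (x + k) := by
  simp [poch, Finset.prod_range_succ]

lemma poch_add (x : R) (j i : ℕ) : poch x (j + i) = poch x j * poch (x + j) i := by
  simp only [poch, Finset.prod_range_add]
  congr 1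
  exact Finset.prod_congr rfl fun i _ => by push_cast; ring

lemma poch_succ_left (x : R) (k : ℕ) : poch x (k + 1) = x * poch (x + 1) k := by
  rw [add_comm k 1, poch_add, poch_succ]; simp

lemma poch_neg_eq_zero {n k : ℕ} (h : n < k) : poch (-(n : R)) k = 0 :=
  Finset.prod_eq_zero (Finset.mem_range.2 h) (by simp)

lemma poch_one (k : ℕ) : poch (1 : R) k = (k.factorial : R) := by
  induction k with
  | zero => simp
  | succ k ih => rw [poch_succ, ih, Nat.factorial_succ]; push_cast; ring

end Poch

/-! ### Terminating summations proved by telescoping certificates -/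

section Identities

variable {K : Type*} [Field K]

lemma poch_ne_zero {x : K} (h : ∀ i : ℕ, x + i ≠ 0) (k : ℕ) : poch x k ≠ 0 :=
  Finset.prod_ne_zero_iff.2 fun i _ => h i

variable [CharZero K]

lemma poch_one_ne_zero (k : ℕ) : poch (1 : K) k ≠ 0 := by
  rw [poch_one]; exact_mod_cast k.factorial_ne_zero

/-- The certificate for `sum_wellPoised_five`. -/
lemma wellPoised_five_telescope (a b c : K) (hA : ∀ i : ℕ, 1 + a + i ≠ 0)
    (hb : ∀ i : ℕ, 1 + a - b + i ≠ 0) (hc : ∀ i : ℕ, 1 + a - c + i ≠ 0) (n m : ℕ) :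
    ∑ k ∈ Finset.range (m + 1), ((1 + a - b + n) * (1 + a - c + n) *
        ((a + 2 * k) * (poch a k * poch b k * poch c k * poch (-((n + 1 : ℕ) : K)) k) /
          (poch 1 k * poch (1 + a - b) k * poch (1 + a - c) k * poch (1 + a + (n + 1 : ℕ)) k)) -
        (1 + a + n) * (1 + a - b - c + n) *
        ((a + 2 * k) * (poch a k * poch b k * poch c k * poch (-(n : K)) k) /
          (poch 1 k * poch (1 + a - b) k * poch (1 + a - c) k * poch (1 + a + n) k))) =
      poch a (m + 1) * poch b (m + 1) * poch c (m + 1) * poch (-(n : K)) m /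
        (poch 1 m * poch (1 + a - b) m * poch (1 + a - c) m * poch (1 + a + (n + 1 : ℕ)) m) := by
  induction m with
  | zero => simp [poch_succ]; ring
  | succ m ih =>
    rw [Finset.sum_range_succ, ih]
    have h1 := poch_one_ne_zero (K := K) m
    have h2 := poch_ne_zero hb m
    have h3 := poch_ne_zero hc m
    have hAn : ∀ i : ℕ, 1 + a + (n + 1 : ℕ) + i ≠ 0 := fun i => by
      have := hA (n + 1 + i); push_cast at this ⊢; rwa [← add_assoc] at this
    have h4 := poch_ne_zero hAn m
    have e1 : poch (-((n + 1 : ℕ) : K)) (m + 1) = -(n + 1) * poch (-(n : K)) m := by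
      rw [poch_succ_left]; push_cast; ring_nf
    have e2 : poch (1 + a + n) (m + 1) = (1 + a + n) * poch (1 + a + (n + 1 : ℕ)) m := by
      rw [poch_succ_left]; push_cast; ring_nf
    have g1 : (1 + m : K) ≠ 0 := by exact_mod_cast (by omega : 1 + m ≠ 0)
    have g2 := hb m
    have g3 := hc m
    have g4 := hAn m
    have g5 := hA n
    rw [e1, e2]
    simp only [poch_succ]
    push_cast at *
    generalize poch a m = X1 at *
    generalize poch b m = X2 at *
    generalize poch c m = X3 at *
    generalize poch (-(n : K)) m = X4 at *
    generalize poch (1 : K) m = Y1 at *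
    generalize poch (1 + a - b) m = Y2 at *
    generalize poch (1 + a - c) m = Y3 at *
    generalize poch (1 + a + (n + 1)) m = Y4 at *
    field_simp
    ring

/-- The terminating very-well-poised `₅F₄(1)` summation. -/
theorem sum_wellPoised_five (a b c : K) (hA : ∀ i : ℕ, 1 + a + i ≠ 0)
    (hb : ∀ i : ℕ, 1 + a - b + i ≠ 0) (hc : ∀ i : ℕ, 1 + a - c + i ≠ 0) (n : ℕ) :
    ∑ k ∈ Finset.range (n + 1), (a + 2 * k) * (poch a k * poch b k * poch c k * poch (-(n : K)) k) /
        (poch 1 k * poch (1 + a - b) k * poch (1 + a - c) k * poch (1 + a + n) k) =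
      a * (poch (1 + a) n * poch (1 + a - b - c) n) / (poch (1 + a - b) n * poch (1 + a - c) n) := by
  induction n with
  | zero => simp
  | succ n ih =>
    -- Summed up to k = n + 1, the certificate's boundary term contains (-n)_{n+1} = 0, so what
    -- remains is a first-order recurrence in n for the whole sum.
    have h := wellPoised_five_telescope a b c hA hb hc n (n + 1)
    have h0 : poch (-(n : K)) (n + 1) = 0 := poch_neg_eq_zero (Nat.lt_succ_self n)
    rw [h0, Finset.sum_sub_distrib, ← Finset.mul_sum, ← Finset.mul_sum] at h
    have g2 := hb n
    have g3 := hc n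
    have h2 := poch_ne_zero hb n
    have h3 := poch_ne_zero hc n
    simp only [mul_zero, zero_div] at h
    rw [sub_eq_zero] at h
    refine mul_left_cancel₀ (mul_ne_zero g2 g3) (h.trans ?_)
    rw [Finset.sum_range_succ, h0, ih]
    simp only [poch_succ, mul_zero, zero_div, add_zero]
    field_simp

/-- The certificate for `sum_wellPoised_four`. -/
lemma wellPoised_four_telescope (a b : K) (hA : ∀ i : ℕ, 1 + a + i ≠ 0)
    (hb : ∀ i : ℕ, 1 + a - b + i ≠ 0) (n m : ℕ) :
    ∑ k ∈ Finset.range (m + 1), ((1 + a - b + n) *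
        ((a + 2 * k) * (poch a k * poch b k * poch (-((n + 1 : ℕ) : K)) k) /
          (poch 1 k * poch (1 + a - b) k * poch (1 + a + (n + 1 : ℕ)) k) * (-1) ^ k) -
        (1 + a + n) *
        ((a + 2 * k) * (poch a k * poch b k * poch (-(n : K)) k) /
          (poch 1 k * poch (1 + a - b) k * poch (1 + a + n) k) * (-1) ^ k)) =
      - (poch a (m + 1) * poch b (m + 1) * poch (-(n : K)) m) /
        (poch 1 m * poch (1 + a - b) m * poch (1 + a + (n + 1 : ℕ)) m) * (-1) ^ m := by
  induction m with
  | zero => simp [poch_succ]; ring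
  | succ m ih =>
    rw [Finset.sum_range_succ, ih]
    have h1 := poch_one_ne_zero (K := K) m
    have h2 := poch_ne_zero hb m
    have hAn : ∀ i : ℕ, 1 + a + (n + 1 : ℕ) + i ≠ 0 := fun i => by
      have := hA (n + 1 + i); push_cast at this ⊢; rwa [← add_assoc] at this
    have h4 := poch_ne_zero hAn m
    have e1 : poch (-((n + 1 : ℕ) : K)) (m + 1) = -(n + 1) * poch (-(n : K)) m := by
      rw [poch_succ_left]; push_cast; ring_nf
    have e2 : poch (1 + a + n) (m + 1) = (1 + a + n) * poch (1 + a + (n + 1 : ℕ)) m := by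
      rw [poch_succ_left]; push_cast; ring_nf
    have g1 : (1 + m : K) ≠ 0 := by exact_mod_cast (by omega : 1 + m ≠ 0)
    have g2 := hb m
    have g4 := hAn m
    have g5 := hA n
    rw [e1, e2]
    simp only [poch_succ]
    push_cast at *
    generalize poch a m = X1 at *
    generalize poch b m = X2 at *
    generalize poch (-(n : K)) m = X4 at *
    generalize poch (1 : K) m = Y1 at *
    generalize poch (1 + a - b) m = Y2 at *
    generalize poch (1 + a + (n + 1)) m = Y4 at *
    field_simp
    ring

/-- The terminating very-well-poised `₄F₃(-1)` summation. -/
theorem sum_wellPoised_four (a b : K) (hA : ∀ i : ℕ, 1 + a + i ≠ 0)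
    (hb : ∀ i : ℕ, 1 + a - b + i ≠ 0) (n : ℕ) :
    ∑ k ∈ Finset.range (n + 1), (a + 2 * k) * (poch a k * poch b k * poch (-(n : K)) k) /
        (poch 1 k * poch (1 + a - b) k * poch (1 + a + n) k) * (-1) ^ k =
      a * poch (1 + a) n / poch (1 + a - b) n := by
  induction n with
  | zero => simp
  | succ n ih =>
    have h := wellPoised_four_telescope a b hA hb n (n + 1)
    have h0 : poch (-(n : K)) (n + 1) = 0 := poch_neg_eq_zero (Nat.lt_succ_self n)
    rw [h0, Finset.sum_sub_distrib, ← Finset.mul_sum, ← Finset.mul_sum] at h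
    have g2 := hb n
    have h2 := poch_ne_zero hb n
    simp only [mul_zero, zero_div, neg_zero, zero_mul] at h
    rw [sub_eq_zero] at h
    refine mul_left_cancel₀ g2 (h.trans ?_)
    rw [Finset.sum_range_succ, h0, ih]
    simp only [poch_succ, mul_zero, zero_mul, zero_div, add_zero]
    field_simp

/-- The certificate for `sum_saalschuetz`. -/
lemma saalschuetz_telescope (a f g : K) (hf : ∀ i : ℕ, f + i ≠ 0) (hg : ∀ i : ℕ, g + i ≠ 0)
    (n m : ℕ) :
    ∑ j ∈ Finset.range (m + 1), ((f + n) * (g + n) *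
        (poch (-((n + 1 : ℕ) : K)) j * poch (a + (n + 1 : ℕ)) j * poch (f + g - 1 - a) j /
          (poch 1 j * poch f j * poch g j)) -
        (1 + a - f + n) * (1 + a - g + n) *
        (poch (-(n : K)) j * poch (a + n) j * poch (f + g - 1 - a) j /
          (poch 1 j * poch f j * poch g j))) =
      (1 + a + 2 * n) * (poch (-(n : K)) m * poch (a + (n + 1 : ℕ)) m *
        poch (f + g - 1 - a) (m + 1)) / (poch 1 m * poch f m * poch g m) := by
  induction m with
  | zero => simp [poch_succ]; ring
  | succ m ih =>
    rw [Finset.sum_range_succ, ih]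
    have h1 := poch_one_ne_zero (K := K) m
    have h2 := poch_ne_zero hf m
    have h3 := poch_ne_zero hg m
    have e1 : poch (-((n + 1 : ℕ) : K)) (m + 1) = -(n + 1) * poch (-(n : K)) m := by
      rw [poch_succ_left]; push_cast; ring_nf
    have e2 : poch (a + n) (m + 1) = (a + n) * poch (a + (n + 1 : ℕ)) m := by
      rw [poch_succ_left]; push_cast; ring_nf
    have g1 : (1 + m : K) ≠ 0 := by exact_mod_cast (by omega : 1 + m ≠ 0)
    have g2 := hf m
    have g3 := hg m
    rw [e1, e2]
    simp only [poch_succ]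
    push_cast at *
    generalize poch (-(n : K)) m = X4 at *
    generalize poch (f + g - 1 - a) m = X5 at *
    generalize poch (1 : K) m = Y1 at *
    generalize poch f m = Y2 at *
    generalize poch g m = Y3 at *
    generalize poch (a + (n + 1)) m = Y4 at *
    field_simp
    ring

/-- The Pfaff–Saalschütz summation, in the form used for Bailey's lemma. -/
theorem sum_saalschuetz (a f g : K) (hf : ∀ i : ℕ, f + i ≠ 0) (hg : ∀ i : ℕ, g + i ≠ 0)
    (n : ℕ) :
    ∑ j ∈ Finset.range (n + 1), poch (-(n : K)) j * poch (a + n) j * poch (f + g - 1 - a) j /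
        (poch 1 j * poch f j * poch g j) =
      poch (1 + a - f) n * poch (1 + a - g) n / (poch f n * poch g n) := by
  induction n with
  | zero => simp
  | succ n ih =>
    have h := saalschuetz_telescope a f g hf hg n (n + 1)
    have h0 : poch (-(n : K)) (n + 1) = 0 := poch_neg_eq_zero (Nat.lt_succ_self n)
    rw [h0, Finset.sum_sub_distrib, ← Finset.mul_sum, ← Finset.mul_sum] at h
    have g2 := hf n
    have g3 := hg n
    have h2 := poch_ne_zero hf n
    have h3 := poch_ne_zero hg n
    simp only [mul_zero, zero_div, zero_mul] at h
    rw [sub_eq_zero] at h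
    refine mul_left_cancel₀ (mul_ne_zero g2 g3) (h.trans ?_)
    rw [Finset.sum_range_succ, h0, ih]
    simp only [poch_succ, zero_mul, zero_div, add_zero]
    field_simp

end Identities

/-! ### Whipple's transformation by Bailey's method -/

section Whipple

variable {K : Type*} [Field K]

lemma poch_neg_add_mul (j i : ℕ) :
    poch (-((j + i : ℕ) : K)) j * poch 1 i = (-1) ^ j * poch 1 (j + i) := by
  induction j with
  | zero => simp
  | succ j ih =>
    have e : poch (-((j + 1 + i : ℕ) : K)) (j + 1) =
        -((j + i : ℕ) + 1) * poch (-((j + i : ℕ) : K)) j := by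
      rw [poch_succ_left]; push_cast; ring_nf
    rw [e, mul_assoc, ih, show j + 1 + i = j + i + 1 by omega, poch_succ]
    push_cast
    ring

variable [CharZero K]

/-- The inner sum in Bailey's proof of `sum_wellPoised_six`. -/
lemma sum_wellPoised_four_shift (a d : K) (hA : ∀ i : ℕ, 1 + a + i ≠ 0)
    (hd : ∀ i : ℕ, 1 + a - d + i ≠ 0) (j n : ℕ) :
    ∑ i ∈ Finset.range (n + 1), (a + 2 * (j + i : ℕ)) *
        (poch a (j + i) * poch d (j + i) * poch (-((j + n : ℕ) : K)) (j + i)) /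
        (poch 1 (j + i) * poch (1 + a - d) (j + i) * poch (1 + a + (j + n : ℕ)) (j + i)) *
        (-1) ^ (j + i) * (poch (-((j + i : ℕ) : K)) j * poch (a + (j + i : ℕ)) j) =
      a * poch (1 + a) (j + n) / poch (1 + a - d) (j + n) *
        (poch d j * poch (-((j + n : ℕ) : K)) j) := by
  have hA' : ∀ i : ℕ, 1 + (a + 2 * j) + i ≠ 0 := fun i => by
    have := hA (2 * j + i); push_cast at this; rwa [← add_assoc, add_assoc 1 a] at this
  have hd' : ∀ i : ℕ, 1 + (a + 2 * j) - (d + j) + i ≠ 0 := fun i => by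
    have := hd (j + i); push_cast at this; convert this using 1; ring
  have hn : ∀ i : ℕ, 1 + a + (j + n : ℕ) + i ≠ 0 := fun i => by
    have := hA (j + n + i); push_cast at this ⊢; convert this using 1; ring
  -- After the substitution k = j + i the series is again a very-well-poised ₄F₃(-1), with a, d, -(j
  -- + n) replaced by a + 2j, d + j, -n.
  have key := sum_wellPoised_four (a + 2 * j) (d + j) hA' hd' n
  have e1 : 1 + (a + 2 * j) - (d + j) = 1 + a - d + j := by ring
  have e2 : 1 + (a + 2 * j) + (n : K) = 1 + a + (j + n : ℕ) + j := by push_cast; ring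
  rw [e1, e2] at key
  have h1 := poch_ne_zero hd j
  have h1' := poch_ne_zero hd (j + n)
  have h2 := poch_ne_zero hn j
  have step : ∀ i ∈ Finset.range (n + 1), (a + 2 * (j + i : ℕ)) *
        (poch a (j + i) * poch d (j + i) * poch (-((j + n : ℕ) : K)) (j + i)) /
        (poch 1 (j + i) * poch (1 + a - d) (j + i) * poch (1 + a + (j + n : ℕ)) (j + i)) *
        (-1) ^ (j + i) * (poch (-((j + i : ℕ) : K)) j * poch (a + (j + i : ℕ)) j) =
      (poch a (2 * j) * poch d j * poch (-((j + n : ℕ) : K)) j /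
        (poch (1 + a - d) j * poch (1 + a + (j + n : ℕ)) j)) *
      ((a + 2 * j + 2 * i) * (poch (a + 2 * j) i * poch (d + j) i * poch (-(n : K)) i) /
        (poch 1 i * poch (1 + a - d + j) i * poch (1 + a + (j + n : ℕ) + j) i) * (-1) ^ i) := by
    intro i _
    have h3 := poch_one_ne_zero (K := K) i
    have h4 := poch_one_ne_zero (K := K) (j + i)
    have h5 := poch_neg_add_mul (K := K) j i
    have h6 : poch a (j + i) * poch (a + (j + i : ℕ)) j = poch a (2 * j) * poch (a + 2 * j) i := by
      have := poch_add a (2 * j) i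
      push_cast at this
      rw [← poch_add, ← this]; congr 1; ring
    have h7 : poch (1 + a - d + j) i ≠ 0 := by
      rw [← e1]; exact poch_ne_zero hd' i
    have h8 : poch (1 + a + (j + n : ℕ) + j) i ≠ 0 := by
      have := poch_ne_zero hn (j + i)
      rw [poch_add] at this
      exact right_ne_zero_of_mul this
    have h9 : poch (-((j + n : ℕ) : K)) (j + i) = poch (-((j + n : ℕ) : K)) j * poch (-(n : K)) i := by
      rw [poch_add]; push_cast; ring_nf
    rw [h9, poch_add d, poch_add (1 + a - d), poch_add (1 + a + (j + n : ℕ))]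
    have h5' : poch (-((j + i : ℕ) : K)) j = (-1) ^ j * poch 1 (j + i) / poch 1 i := by
      rw [← h5]; field_simp
    have hs : ((-1 : K) ^ j) * (-1) ^ j = 1 := by rw [← mul_pow]; simp
    rw [h5']
    have hs2 : ((-1 : K) ^ (j + i)) * (-1) ^ j = (-1) ^ i := by
      rw [pow_add, mul_right_comm, hs, one_mul]
    rw [← hs2]
    have hc : (a + 2 * ((j + i : ℕ) : K)) = a + 2 * j + 2 * i := by push_cast; ring
    rw [hc]
    calc _ = (a + 2 * j + 2 * i) * (poch a (j + i) * poch (a + (j + i : ℕ)) j) *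
          (poch d j * poch (d + j) i * (poch (-((j + n : ℕ) : K)) j * poch (-(n : K)) i)) *
          ((-1) ^ (j + i) * (-1) ^ j) / (poch 1 i * (poch (1 + a - d) j * poch (1 + a - d + j) i) *
          (poch (1 + a + (j + n : ℕ)) j * poch (1 + a + (j + n : ℕ) + j) i)) := by
          field_simp
      _ = _ := by rw [h6]; field_simp
  rw [Finset.sum_congr rfl step, ← Finset.mul_sum, key]
  have h10 : poch a (2 * j) * ((a + 2 * j) * poch (1 + (a + 2 * j)) n) =
      a * poch (1 + a) (j + n) * poch (1 + a + (j + n : ℕ)) j := by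
    have t1 := poch_add (1 + a) (j + n) j
    have t2 := poch_succ_left (a + 2 * j) n
    have t3 := poch_add a (2 * j) (n + 1)
    have t4 := poch_succ_left a (j + n + j)
    push_cast at t3
    rw [show 1 + (a + 2 * (j : K)) = a + 2 * j + 1 by ring, ← t2, ← t3, mul_assoc, ← t1,
      add_comm 1 a, ← t4]
    congr 1; omega
  have h11 := poch_add (1 + a - d) j n
  have h12 : poch (1 + a - d + j) n ≠ 0 := right_ne_zero_of_mul (h11 ▸ h1')
  rw [h11]
  field_simp
  linear_combination (poch d j * poch (-((j + n : ℕ) : K)) j) * h10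

/-- Whipple's transformation of a terminating very-well-poised `₆F₅(-1)` into a `₃F₂(1)`. -/
theorem sum_wellPoised_six (a b c d : K) (hA : ∀ i : ℕ, 1 + a + i ≠ 0)
    (hb : ∀ i : ℕ, 1 + a - b + i ≠ 0) (hc : ∀ i : ℕ, 1 + a - c + i ≠ 0)
    (hd : ∀ i : ℕ, 1 + a - d + i ≠ 0) (n : ℕ) :
    ∑ k ∈ Finset.range (n + 1), (a + 2 * k) *
        (poch a k * poch b k * poch c k * poch d k * poch (-(n : K)) k) /
        (poch 1 k * poch (1 + a - b) k * poch (1 + a - c) k * poch (1 + a - d) k *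
          poch (1 + a + n) k) * (-1) ^ k =
      a * poch (1 + a) n / poch (1 + a - d) n *
        ∑ j ∈ Finset.range (n + 1), poch (1 + a - b - c) j * poch d j * poch (-(n : K)) j /
          (poch 1 j * poch (1 + a - b) j * poch (1 + a - c) j) := by
  -- Bailey's device: expand the pair of parameters b, c by Pfaff–Saalschütz, then interchange the
  -- two summations, so that the inner sum no longer involves b and c.
  have saal : ∀ k : ℕ, poch b k * poch c k / (poch (1 + a - b) k * poch (1 + a - c) k) =
      ∑ j ∈ Finset.range (k + 1), poch (-(k : K)) j * poch (a + k) j * poch (1 + a - b - c) j /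
        (poch 1 j * poch (1 + a - b) j * poch (1 + a - c) j) := fun k => by
    have := sum_saalschuetz a (1 + a - b) (1 + a - c) hb hc k
    rw [show 1 + a - (1 + a - b) = b by ring, show 1 + a - (1 + a - c) = c by ring] at this
    rw [← this]
    refine Finset.sum_congr rfl fun j _ => ?_
    rw [show 1 + a - b + (1 + a - c) - 1 - a = 1 + a - b - c by ring]
  let F : ℕ → ℕ → K := fun j i => (a + 2 * (j + i : ℕ)) *
        (poch a (j + i) * poch d (j + i) * poch (-(n : K)) (j + i)) /
        (poch 1 (j + i) * poch (1 + a - d) (j + i) * poch (1 + a + n) (j + i)) *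
        (-1) ^ (j + i) * (poch (-((j + i : ℕ) : K)) j * poch (a + (j + i : ℕ)) j) *
        (poch (1 + a - b - c) j / (poch 1 j * poch (1 + a - b) j * poch (1 + a - c) j))
  have h1 : ∀ k ∈ Finset.range (n + 1), (a + 2 * k) *
        (poch a k * poch b k * poch c k * poch d k * poch (-(n : K)) k) /
        (poch 1 k * poch (1 + a - b) k * poch (1 + a - c) k * poch (1 + a - d) k *
          poch (1 + a + n) k) * (-1) ^ k = ∑ j ∈ Finset.range (k + 1), F j (k - j) := by
    intro k _
    have : (a + 2 * k) *
        (poch a k * poch b k * poch c k * poch d k * poch (-(n : K)) k) /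
        (poch 1 k * poch (1 + a - b) k * poch (1 + a - c) k * poch (1 + a - d) k *
          poch (1 + a + n) k) * (-1) ^ k = (a + 2 * k) *
        (poch a k * poch d k * poch (-(n : K)) k) /
        (poch 1 k * poch (1 + a - d) k * poch (1 + a + n) k) * (-1) ^ k *
        (poch b k * poch c k / (poch (1 + a - b) k * poch (1 + a - c) k)) := by
      simp only [div_eq_mul_inv, mul_inv]; ring
    rw [this, saal, Finset.mul_sum]
    refine Finset.sum_congr rfl fun j hj => ?_
    have hjk : j + (k - j) = k := by have := Finset.mem_range.1 hj; omega
    simp only [F, hjk]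
    ring
  rw [Finset.sum_congr rfl h1, Finset.sum_range_diag_flip, Finset.mul_sum]
  refine Finset.sum_congr rfl fun j hj => ?_
  obtain ⟨m, rfl⟩ : ∃ m, n = j + m := ⟨n - j, by have := Finset.mem_range.1 hj; omega⟩
  rw [show j + m + 1 - j = m + 1 by omega]
  simp only [F]
  rw [← Finset.sum_mul, sum_wellPoised_four_shift a d hA hd j m]
  ring

end Whipple

/-! ### Congruence calculus in ℚ_p: first- and second-order expansions in p -/

section Congruence

variable {p : ℕ} [Fact p.Prime] {n : ℕ} {a b c d x y A B u v : ℚ_[p]}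

/-- Membership in `ℤ_p`. -/
def IsInt (x : ℚ_[p]) : Prop := x ∈ PadicInt.subring p

/-- Being a unit of `ℤ_p`. -/
def IsPUnit (x : ℚ_[p]) : Prop := ‖x‖ = 1

lemma isInt_iff : IsInt x ↔ ‖x‖ ≤ 1 := Iff.rfl

lemma IsInt.exists_coe (h : IsInt x) : ∃ z : ℤ_[p], (z : ℚ_[p]) = x := ⟨⟨x, h⟩, rfl⟩

lemma isInt_coe (z : ℤ_[p]) : IsInt (z : ℚ_[p]) := z.2

lemma IsInt.add (hx : IsInt x) (hy : IsInt y) : IsInt (x + y) := add_mem hx hy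
lemma IsInt.sub (hx : IsInt x) (hy : IsInt y) : IsInt (x - y) := sub_mem hx hy
lemma IsInt.mul (hx : IsInt x) (hy : IsInt y) : IsInt (x * y) := mul_mem hx hy
lemma IsInt.neg (hx : IsInt x) : IsInt (-x) := neg_mem hx
lemma IsInt.pow (hx : IsInt x) (k : ℕ) : IsInt (x ^ k) := pow_mem hx k
lemma isInt_natCast (k : ℕ) : IsInt (k : ℚ_[p]) := natCast_mem _ k
lemma isInt_intCast (k : ℤ) : IsInt (k : ℚ_[p]) := intCast_mem _ k
lemma isInt_one : IsInt (1 : ℚ_[p]) := one_mem _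
lemma isInt_zero : IsInt (0 : ℚ_[p]) := zero_mem _
lemma isInt_ofNat (k : ℕ) [k.AtLeastTwo] : IsInt (OfNat.ofNat k : ℚ_[p]) :=
  ofNat_mem _ k
lemma IsInt.prod {ι : Type*} {s : Finset ι} {f : ι → ℚ_[p]} (h : ∀ i ∈ s, IsInt (f i)) :
    IsInt (∏ i ∈ s, f i) := prod_mem h

lemma IsPUnit.isInt (h : IsPUnit x) : IsInt x := le_of_eq h
lemma IsPUnit.ne_zero (h : IsPUnit x) : x ≠ 0 := by
  rintro rfl; simp [IsPUnit] at h
lemma IsPUnit.mul (hx : IsPUnit x) (hy : IsPUnit y) : IsPUnit (x * y) := by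
  unfold IsPUnit at *; rw [norm_mul, hx, hy, one_mul]
lemma IsPUnit.inv (hx : IsPUnit x) : IsPUnit x⁻¹ := by
  unfold IsPUnit at *; rw [norm_inv, hx, inv_one]
lemma IsPUnit.div (hx : IsPUnit x) (hy : IsPUnit y) : IsPUnit (x / y) := by
  rw [div_eq_mul_inv]; exact hx.mul hy.inv
lemma IsPUnit.neg (hx : IsPUnit x) : IsPUnit (-x) := by
  unfold IsPUnit at *; rw [norm_neg, hx]
lemma IsPUnit.pow (hx : IsPUnit x) (k : ℕ) : IsPUnit (x ^ k) := by
  unfold IsPUnit at *; rw [norm_pow, hx, one_pow]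
lemma isPUnit_one : IsPUnit (1 : ℚ_[p]) := norm_one
lemma IsPUnit.prod {ι : Type*} {s : Finset ι} {f : ι → ℚ_[p]} (h : ∀ i ∈ s, IsPUnit (f i)) :
    IsPUnit (∏ i ∈ s, f i) := by
  unfold IsPUnit at *; rw [norm_prod, Finset.prod_eq_one h]
lemma IsInt.div (hx : IsInt x) (hy : IsPUnit y) : IsInt (x / y) := by
  rw [div_eq_mul_inv]; exact hx.mul hy.inv.isInt

lemma isPUnit_natCast {k : ℕ} (h : ¬ p ∣ k) : IsPUnit (k : ℚ_[p]) := by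
  rw [IsPUnit, Padic.norm_natCast_eq_one_iff]
  exact (Nat.Prime.coprime_iff_not_dvd Fact.out).2 h

lemma isPUnit_natCast_of_lt {k : ℕ} (h0 : 0 < k) (h : k < p) : IsPUnit (k : ℚ_[p]) :=
  isPUnit_natCast (Nat.not_dvd_of_pos_of_lt h0 h)

lemma modEq_iff : PadicModEq p n a b ↔ ∃ z : ℚ_[p], IsInt z ∧ a - b = (p : ℚ_[p]) ^ n * z :=
  ⟨fun ⟨z, hz⟩ => ⟨z, isInt_coe z, hz⟩, fun ⟨z, hz, h⟩ => ⟨⟨z, hz⟩, h⟩⟩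

namespace PadicModEq

lemma of_eq (h : a = b) : PadicModEq p n a b := ⟨0, by simp [h]⟩

lemma refl (n : ℕ) (a : ℚ_[p]) : PadicModEq p n a a := of_eq rfl

lemma symm (h : PadicModEq p n a b) : PadicModEq p n b a := by
  obtain ⟨z, hz⟩ := h
  exact ⟨-z, by push_cast; linear_combination -hz⟩

lemma trans (h : PadicModEq p n a b) (h' : PadicModEq p n b c) : PadicModEq p n a c := by
  obtain ⟨z, hz⟩ := h
  obtain ⟨w, hw⟩ := h'
  exact ⟨z + w, by push_cast; linear_combination hz + hw⟩

lemma add (h : PadicModEq p n a b) (h' : PadicModEq p n c d) : PadicModEq p n (a + c) (b + d) := by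
  obtain ⟨z, hz⟩ := h
  obtain ⟨w, hw⟩ := h'
  exact ⟨z + w, by push_cast; linear_combination hz + hw⟩

lemma neg (h : PadicModEq p n a b) : PadicModEq p n (-a) (-b) := by
  obtain ⟨z, hz⟩ := h
  exact ⟨-z, by push_cast; linear_combination -hz⟩

lemma sub (h : PadicModEq p n a b) (h' : PadicModEq p n c d) : PadicModEq p n (a - c) (b - d) := by
  rw [sub_eq_add_neg, sub_eq_add_neg]; exact h.add h'.neg

lemma sum {ι : Type*} {s : Finset ι} {f g : ι → ℚ_[p]}
    (h : ∀ i ∈ s, PadicModEq p n (f i) (g i)) :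
    PadicModEq p n (∑ i ∈ s, f i) (∑ i ∈ s, g i) := by
  classical
  induction s using Finset.induction_on with
  | empty => exact refl (p := p) n _
  | insert i s hi ih =>
    rw [Finset.sum_insert hi, Finset.sum_insert hi]
    exact (h i (Finset.mem_insert_self i s)).add
      (ih fun j hj => h j (Finset.mem_insert_of_mem hj))

lemma isInt (h : PadicModEq p n a b) (hb : IsInt b) : IsInt a := by
  obtain ⟨z, hz⟩ := h
  rw [show a = b + (p : ℚ_[p]) ^ n * z by linear_combination hz]
  exact hb.add (((isInt_natCast p).pow n).mul (isInt_coe z))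

lemma mul_of_isInt (h : PadicModEq p n a b) (h' : PadicModEq p n c d) (hb : IsInt b)
    (hd : IsInt d) : PadicModEq p n (a * c) (b * d) := by
  obtain ⟨x, rfl⟩ := (h.isInt hb).exists_coe
  obtain ⟨y, rfl⟩ := hd.exists_coe
  obtain ⟨z, hz⟩ := h
  obtain ⟨w, hw⟩ := h'
  exact ⟨x * w + y * z, by push_cast; linear_combination (x : ℚ_[p]) * hw + (y : ℚ_[p]) * hz⟩

lemma const_mul (h : PadicModEq p n a b) (hc : IsInt c) : PadicModEq p n (c * a) (c * b) := by
  obtain ⟨x, rfl⟩ := hc.exists_coe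
  obtain ⟨z, hz⟩ := h
  exact ⟨x * z, by push_cast; linear_combination (x : ℚ_[p]) * hz⟩

lemma mul_const (h : PadicModEq p n a b) (hc : IsInt c) : PadicModEq p n (a * c) (b * c) := by
  rw [mul_comm a, mul_comm b]; exact h.const_mul hc

lemma pow (h : PadicModEq p n a b) (hb : IsInt b) (k : ℕ) :
    PadicModEq p n (a ^ k) (b ^ k) := by
  induction k with
  | zero => exact of_eq (by simp)
  | succ k ih => rw [pow_succ, pow_succ]; exact ih.mul_of_isInt h (hb.pow k) hb

lemma prod {ι : Type*} {s : Finset ι} {f g : ι → ℚ_[p]}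
    (h : ∀ i ∈ s, PadicModEq p n (f i) (g i)) (hg : ∀ i ∈ s, IsInt (g i)) :
    PadicModEq p n (∏ i ∈ s, f i) (∏ i ∈ s, g i) := by
  classical
  induction s using Finset.induction_on with
  | empty => exact refl (p := p) n _
  | insert i s hi ih =>
    rw [Finset.prod_insert hi, Finset.prod_insert hi]
    exact mul_of_isInt (h i (Finset.mem_insert_self i s))
      (ih (fun j hj => h j (Finset.mem_insert_of_mem hj))
        fun j hj => hg j (Finset.mem_insert_of_mem hj))
      (hg i (Finset.mem_insert_self i s)) (IsInt.prod fun j hj => hg j (Finset.mem_insert_of_mem hj))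

lemma inv (h : PadicModEq p n a b) (ha : IsPUnit a) (hb : IsPUnit b) :
    PadicModEq p n a⁻¹ b⁻¹ := by
  obtain ⟨x, hx⟩ := (ha.inv.mul hb.inv).isInt.exists_coe
  obtain ⟨z, hz⟩ := h
  refine ⟨-(x * z), ?_⟩
  have h1 := ha.ne_zero
  have h2 := hb.ne_zero
  push_cast
  rw [hx]
  field_simp
  linear_combination -hz

lemma p_mul (h : PadicModEq p n a b) :
    PadicModEq p (n + 1) ((p : ℚ_[p]) * a) ((p : ℚ_[p]) * b) := by
  obtain ⟨z, hz⟩ := h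
  exact ⟨z, by rw [pow_succ]; linear_combination (p : ℚ_[p]) * hz⟩

lemma of_p_mul (h : PadicModEq p (n + 1) ((p : ℚ_[p]) * a) ((p : ℚ_[p]) * b)) : PadicModEq p n a b := by
  obtain ⟨z, hz⟩ := h
  have hp : (p : ℚ_[p]) ≠ 0 := by exact_mod_cast (Fact.out : p.Prime).ne_zero
  exact ⟨z, mul_left_cancel₀ hp (by rw [pow_succ] at hz; linear_combination hz)⟩

lemma isPUnit (h : PadicModEq p (n + 1) a b) (hb : IsPUnit b) : IsPUnit a := by
  obtain ⟨z, hz⟩ := h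
  have h1 : ‖a - b‖ < ‖b‖ := by
    rw [hz, show ‖b‖ = 1 from hb, norm_mul, norm_pow]
    calc _ ≤ ‖(p : ℚ_[p])‖ ^ (n + 1) * 1 := by gcongr; exact z.2
      _ < 1 := by rw [mul_one]; exact pow_lt_one₀ (norm_nonneg _) Padic.norm_p_lt_one (by omega)
  rw [IsPUnit, Padic.norm_eq_of_norm_sub_lt_right h1]; exact hb

lemma div (h : PadicModEq p (n + 1) a b) (h' : PadicModEq p (n + 1) c d) (hb : IsInt b)
    (hd : IsPUnit d) : PadicModEq p (n + 1) (a / c) (b / d) := by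
  rw [div_eq_mul_inv, div_eq_mul_inv]
  exact h.mul_of_isInt (h'.inv (h'.isPUnit hd) hd) hb hd.inv.isInt

end PadicModEq

/-- `x ≡ A (1 + p u) (mod p ^ 2)` with `A` and `u` integral. -/
structure FirstOrder (x A u : ℚ_[p]) : Prop where
  isInt_fst : IsInt A
  isInt_snd : IsInt u
  modEq : PadicModEq p 2 x (A * (1 + (p : ℚ_[p]) * u))

namespace FirstOrder

lemma isInt_right (h : FirstOrder x A u) : IsInt (A * (1 + (p : ℚ_[p]) * u)) :=
  h.1.mul (isInt_one.add ((isInt_natCast p).mul h.2))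

lemma mul (h : FirstOrder x A u) (h' : FirstOrder y B v) : FirstOrder (x * y) (A * B) (u + v) := by
  refine ⟨h.1.mul h'.1, h.2.add h'.2, (h.3.mul_of_isInt h'.3 h.isInt_right h'.isInt_right).trans ?_⟩
  rw [modEq_iff]
  exact ⟨A * B * (u * v), (h.1.mul h'.1).mul (h.2.mul h'.2), by ring⟩

lemma isPUnit (h : FirstOrder x A u) (hA : IsPUnit A) : IsPUnit x := by
  have h1 : PadicModEq p (0 + 1) (A * (1 + (p : ℚ_[p]) * u)) A := by
    rw [modEq_iff]; exact ⟨A * u, h.1.mul h.2, by ring⟩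
  exact h.3.isPUnit (h1.isPUnit hA)

lemma inv (h : FirstOrder x A u) (hA : IsPUnit A) : FirstOrder x⁻¹ A⁻¹ (-u) := by
  refine ⟨hA.inv.isInt, h.2.neg, ?_⟩
  have h1 : PadicModEq p (0 + 1) (A * (1 + (p : ℚ_[p]) * u)) A := by
    rw [modEq_iff]; exact ⟨A * u, h.1.mul h.2, by ring⟩
  have h2 := h1.isPUnit hA
  refine (h.3.inv (h.isPUnit hA) h2).trans ?_
  rw [modEq_iff]
  refine ⟨u ^ 2 * (A * (1 + (p : ℚ_[p]) * u))⁻¹, (h.2.pow 2).mul h2.inv.isInt, ?_⟩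
  have h3 := hA.ne_zero
  have h4 : 1 + (p : ℚ_[p]) * u ≠ 0 := right_ne_zero_of_mul h2.ne_zero
  field_simp
  ring

lemma div (h : FirstOrder x A u) (h' : FirstOrder y B v) (hB : IsPUnit B) :
    FirstOrder (x / y) (A / B) (u - v) := by
  rw [div_eq_mul_inv, div_eq_mul_inv, sub_eq_add_neg]; exact h.mul (h'.inv hB)

lemma pow (h : FirstOrder x A u) (k : ℕ) : FirstOrder (x ^ k) (A ^ k) (k * u) := by
  induction k with
  | zero => exact ⟨by simpa using isInt_one, by simpa using isInt_zero, .of_eq (by simp)⟩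
  | succ k ih =>
    rw [pow_succ, pow_succ, show ((k + 1 : ℕ) : ℚ_[p]) * u = k * u + u by push_cast; ring]
    exact ih.mul h

/-- This is what permits exchanging parameters modulo p²: products of shifted rising factorials are
interchangeable once their unit parts and their total first-order coefficients agree. -/
lemma eq (h : FirstOrder x A u) (h' : FirstOrder y B v) (hAB : A = B) (huv : u = v) :
    PadicModEq p 2 x y := by
  subst hAB huv; exact h.3.trans h'.3.symm

end FirstOrder

/-- First-order expansion of a product of shifted units. -/
lemma exists_firstOrder_prod (f : ℕ → ℚ_[p]) (k : ℕ) (hf : ∀ i < k, IsPUnit (f i)) :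
    ∃ σ : ℚ_[p], IsInt σ ∧ ∀ t, IsInt t →
      FirstOrder (∏ i ∈ Finset.range k, (f i + t * (p : ℚ_[p]))) (∏ i ∈ Finset.range k, f i) (t * σ) := by
  induction k with
  | zero => exact ⟨0, isInt_zero, fun t _ => ⟨by simpa using isInt_one, by simpa using isInt_zero,
      .of_eq (by simp)⟩⟩
  | succ k ih =>
    obtain ⟨σ, hσ, h⟩ := ih fun i hi => hf i (by omega)
    have hk := hf k (by omega)
    refine ⟨σ + (f k)⁻¹, hσ.add hk.inv.isInt, fun t ht => ?_⟩
    rw [Finset.prod_range_succ, Finset.prod_range_succ, mul_add t]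
    refine (h t ht).mul ⟨hk.isInt, ht.mul hk.inv.isInt, .of_eq ?_⟩
    have := hk.ne_zero
    field_simp

/-- `x` and `y` are `A (1 ± p u + p ^ 2 c)` modulo `p ^ 3`, for some integral `c`. -/
def SecondOrder (x y A u : ℚ_[p]) : Prop :=
  IsPUnit A ∧ IsInt u ∧ ∃ c, IsInt c ∧ PadicModEq p 3 x (A * (1 + (p : ℚ_[p]) * u + (p : ℚ_[p]) ^ 2 * c)) ∧
    PadicModEq p 3 y (A * (1 - (p : ℚ_[p]) * u + (p : ℚ_[p]) ^ 2 * c))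

namespace SecondOrder

variable {x' y' : ℚ_[p]}

lemma isPUnit_aux (hA : IsPUnit A) (hu : IsInt u) (hc : IsInt c) :
    IsPUnit (A * (1 + (p : ℚ_[p]) * u + (p : ℚ_[p]) ^ 2 * c)) := by
  have h1 : PadicModEq p (0 + 1) (A * (1 + (p : ℚ_[p]) * u + (p : ℚ_[p]) ^ 2 * c)) A := by
    rw [modEq_iff]
    exact ⟨A * (u + (p : ℚ_[p]) * c), hA.isInt.mul (hu.add ((isInt_natCast p).mul hc)), by ring⟩
  exact h1.isPUnit hA

lemma isPUnit_aux' (hA : IsPUnit A) (hu : IsInt u) (hc : IsInt c) :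
    IsPUnit (A * (1 - (p : ℚ_[p]) * u + (p : ℚ_[p]) ^ 2 * c)) := by
  have := isPUnit_aux hA hu.neg hc
  rwa [mul_neg, ← sub_eq_add_neg] at this

lemma mul (h : SecondOrder x y A u) (h' : SecondOrder x' y' B v) :
    SecondOrder (x * x') (y * y') (A * B) (u + v) := by
  obtain ⟨hA, hu, c, hc, h1, h2⟩ := h
  obtain ⟨hB, hv, d, hd, h3, h4⟩ := h'
  have hP := isInt_natCast (p := p) p
  refine ⟨hA.mul hB, hu.add hv, c + d + u * v, (hc.add hd).add (hu.mul hv), ?_, ?_⟩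
  · refine (h1.mul_of_isInt h3 (isPUnit_aux hA hu hc).isInt (isPUnit_aux hB hv hd).isInt).trans ?_
    rw [modEq_iff]
    exact ⟨A * B * (u * d + v * c + (p : ℚ_[p]) * (c * d)), (hA.mul hB).isInt.mul
      (((hu.mul hd).add (hv.mul hc)).add (hP.mul (hc.mul hd))), by ring⟩
  · refine (h2.mul_of_isInt h4 (isPUnit_aux' hA hu hc).isInt (isPUnit_aux' hB hv hd).isInt).trans ?_
    rw [modEq_iff]
    exact ⟨A * B * (-(u * d + v * c) + (p : ℚ_[p]) * (c * d)), (hA.mul hB).isInt.mul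
      (((hu.mul hd).add (hv.mul hc)).neg.add (hP.mul (hc.mul hd))), by ring⟩

lemma pow (h : SecondOrder x y A u) (k : ℕ) :
    SecondOrder (x ^ k) (y ^ k) (A ^ k) (k * u) := by
  induction k with
  | zero => exact ⟨by simpa using isPUnit_one, by simpa using isInt_zero, 0, isInt_zero,
      .of_eq (by simp), .of_eq (by simp)⟩
  | succ k ih =>
    rw [pow_succ, pow_succ, pow_succ,
      show ((k + 1 : ℕ) : ℚ_[p]) * u = k * u + u by push_cast; ring]
    exact ih.mul h

/-- The inverse of 1 ± pu + p²c begins 1 ∓ pu + p²(u² - c). The p² coefficient is even in u, so both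
members of the pair still share it; this sharing is what the central difference exploits. -/
lemma inv (h : SecondOrder x y A u) : SecondOrder x⁻¹ y⁻¹ A⁻¹ (-u) := by
  obtain ⟨hA, hu, c, hc, h1, h2⟩ := h
  have hP := isInt_natCast (p := p) p
  have q1 := isPUnit_aux hA hu hc
  have q2 := isPUnit_aux' hA hu hc
  have h3 := hA.ne_zero
  refine ⟨hA.inv, hu.neg, u ^ 2 - c, (hu.pow 2).sub hc, ?_, ?_⟩
  · refine (h1.inv (h1.isPUnit q1) q1).trans ?_
    rw [modEq_iff]
    refine ⟨(2 * u * c - u ^ 3 - (p : ℚ_[p]) * (c * (u ^ 2 - c))) * (A * (1 + (p : ℚ_[p]) * u + (p : ℚ_[p]) ^ 2 * c))⁻¹,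
      ((((isInt_ofNat 2).mul hu).mul hc).sub (hu.pow 3)|>.sub
        (hP.mul (hc.mul ((hu.pow 2).sub hc)))).mul q1.inv.isInt, ?_⟩
    have h4 : 1 + (p : ℚ_[p]) * u + (p : ℚ_[p]) ^ 2 * c ≠ 0 := right_ne_zero_of_mul q1.ne_zero
    field_simp
    ring
  · refine (h2.inv (h2.isPUnit q2) q2).trans ?_
    rw [modEq_iff]
    refine ⟨(u ^ 3 - 2 * u * c - (p : ℚ_[p]) * (c * (u ^ 2 - c))) * (A * (1 - (p : ℚ_[p]) * u + (p : ℚ_[p]) ^ 2 * c))⁻¹,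
      (((hu.pow 3).sub (((isInt_ofNat 2).mul hu).mul hc)).sub
        (hP.mul (hc.mul ((hu.pow 2).sub hc)))).mul q2.inv.isInt, ?_⟩
    have h4 : 1 - (p : ℚ_[p]) * u + (p : ℚ_[p]) ^ 2 * c ≠ 0 := right_ne_zero_of_mul q2.ne_zero
    field_simp
    ring

/-- The central difference of a second-order expansion times a linear factor. -/
lemma central_difference (h : SecondOrder x y A u) {w : ℚ_[p]} (hw : IsInt w) :
    PadicModEq p 3 ((w + (p : ℚ_[p])) * x - (w - (p : ℚ_[p])) * y) ((p : ℚ_[p]) * (A * (2 + 2 * u * w))) := by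
  obtain ⟨hA, hu, c, hc, h1, h2⟩ := h
  have hP := isInt_natCast (p := p) p
  refine ((h1.const_mul (hw.add hP)).sub (h2.const_mul (hw.sub hP))).trans ?_
  rw [modEq_iff]
  exact ⟨2 * A * c, ((isInt_ofNat 2).mul hA.isInt).mul hc, by ring⟩

end SecondOrder

/-- Second-order expansion of `(1 ± t p)_k`. -/
lemma secondOrder_poch {t : ℚ_[p]} (ht : IsInt t) {k : ℕ} (hk : k < p) :
    SecondOrder (poch (1 + t * (p : ℚ_[p])) k) (poch (1 - t * (p : ℚ_[p])) k) (poch 1 k)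
      (t * ((harmonic k : ℚ) : ℚ_[p])) := by
  induction k with
  | zero => exact ⟨by simpa using isPUnit_one, by simpa using isInt_zero, 0, isInt_zero,
      .of_eq (by simp), .of_eq (by simp)⟩
  | succ k ih =>
    have hu : IsPUnit (1 + (k : ℚ_[p])) := by
      have := isPUnit_natCast_of_lt (p := p) (Nat.succ_pos k) hk
      push_cast at this; rwa [add_comm]
    have h0 := hu.ne_zero
    rw [poch_succ, poch_succ, poch_succ, harmonic_succ]
    have e : t * (((harmonic k + (↑(k + 1))⁻¹ : ℚ)) : ℚ_[p]) =
        t * ((harmonic k : ℚ) : ℚ_[p]) + t * (1 + k : ℚ_[p])⁻¹ := by push_cast; rw [add_comm 1 (k : ℚ_[p])]; ring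
    rw [e]
    refine (ih (by omega)).mul ⟨hu, ht.mul hu.inv.isInt, 0, isInt_zero, .of_eq ?_, .of_eq ?_⟩ <;>
    · field_simp
      ring

end Congruence

/-! ### Vanishing of the well-poised series with a = -n -/

section Antisymmetry

variable {K : Type*} [Field K]

/-- Reverse the order of the factors and change the sign of each. The case j = 0 is the reversal
used repeatedly to turn shifts by 1/2, 1/4 or 3/4 into shifts by multiples of p. -/
lemma poch_reflect (b : K) (j k : ℕ) :
    poch (1 - ((j + k : ℕ) : K) - b) k * poch b j = (-1) ^ k * poch b (j + k) := by
  induction k with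
  | zero => simp
  | succ k ih =>
    have e : poch (1 - ((j + (k + 1) : ℕ) : K) - b) (k + 1) =
        -(b + (j + k : ℕ)) * poch (1 - ((j + k : ℕ) : K) - b) k := by
      rw [poch_succ_left]; push_cast; ring_nf
    rw [e, mul_assoc, ih, show j + (k + 1) = j + k + 1 by omega, poch_succ]
    ring

/-- Apart from the sign (-1)^k, the right-hand side is symmetric under k ↦ n - k. In a well-poised
sum these signs cancel, leaving only the odd factor -n + 2k. -/
lemma poch_div_reflect {b : K} {n k : ℕ} (hk : k ≤ n) (hb : poch b n ≠ 0) :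
    poch b k / poch (1 - n - b) k = (-1) ^ k * (poch b k * poch b (n - k) / poch b n) := by
  obtain ⟨j, rfl⟩ : ∃ j, n = j + k := ⟨n - k, by omega⟩
  have h := poch_reflect b j k
  have h1 : poch b j ≠ 0 := by rw [poch_add] at hb; exact left_ne_zero_of_mul hb
  have h2 : ((-1 : K) ^ k) * (-1) ^ k = 1 := by rw [← mul_pow]; simp
  have h3 : poch (1 - ((j + k : ℕ) : K) - b) k = (-1) ^ k * poch b (j + k) / poch b j := by
    rw [← h]; field_simp
  rw [h3, Nat.add_sub_cancel]
  rw [eq_comm, ← sub_eq_zero]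
  have h4 : ((-1 : K) ^ k) ≠ 0 := by simp
  field_simp
  linear_combination poch b k * poch b j * h2

/-- A well-poised sum with `a = -n` vanishes by antisymmetry. -/
lemma sum_wellPoised_antisymm [CharZero K] {b c d : K} {n : ℕ} (hb : poch b n ≠ 0)
    (hc : poch c n ≠ 0) (hd : poch d n ≠ 0) (m : ℕ) :
    ∑ k ∈ Finset.range (n + 1), (-(n : K) + 2 * k) * (poch b k / poch (1 - n - b) k *
      (poch c k / poch (1 - n - c) k) * (poch d k / poch (1 - n - d) k) ^ m * ((-1) ^ m) ^ k) = 0 := by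
  set f : ℕ → K := fun k => (-(n : K) + 2 * k) * (poch b k * poch b (n - k) / poch b n *
    (poch c k * poch c (n - k) / poch c n) * (poch d k * poch d (n - k) / poch d n) ^ m) with hf
  have h1 : ∑ k ∈ Finset.range (n + 1), (-(n : K) + 2 * k) * (poch b k / poch (1 - n - b) k *
      (poch c k / poch (1 - n - c) k) * (poch d k / poch (1 - n - d) k) ^ m * ((-1) ^ m) ^ k) =
      ∑ k ∈ Finset.range (n + 1), f k := by
    refine Finset.sum_congr rfl fun k hk => ?_
    have hk' : k ≤ n := by have := Finset.mem_range.1 hk; omega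
    rw [poch_div_reflect hk' hb, poch_div_reflect hk' hc, poch_div_reflect hk' hd, hf, mul_pow,
      ← pow_mul, ← pow_mul]
    have h2 : ((-1 : K) ^ k) * (-1) ^ k = 1 := by rw [← mul_pow]; simp
    have h3 : ((-1 : K) ^ (k * m)) * (-1) ^ (m * k) = 1 := by
      rw [mul_comm m k, ← mul_pow]; simp
    linear_combination (-(n : K) + 2 * k) * (poch b k * poch b (n - k) / poch b n *
      (poch c k * poch c (n - k) / poch c n) * (poch d k * poch d (n - k) / poch d n) ^ m) *
      ((-1 : K) ^ (k * m) * (-1) ^ (m * k) * h2 + h3)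
  rw [h1]
  have h4 : ∑ k ∈ Finset.range (n + 1), f k = -∑ k ∈ Finset.range (n + 1), f k := by
    rw [← Finset.sum_neg_distrib, ← Finset.sum_range_reflect]
    refine Finset.sum_congr rfl fun k hk => ?_
    obtain ⟨j, rfl⟩ : ∃ j, n = j + k := ⟨n - k, by have := Finset.mem_range.1 hk; omega⟩
    simp only [hf, show j + k + 1 - 1 - k = j by omega, show j + k - j = k by omega,
      show j + k - k = j by omega]
    push_cast
    ring
  exact self_eq_neg.1 h4

end Antisymmetry

/-! ### From harmonic sums to a single well-poised series -/

section Reduction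

variable {p : ℕ} [Fact p.Prime] {n : ℕ}

lemma cast_p_eq (hp : p = 2 * n + 1) : (p : ℚ_[p]) = 2 * n + 1 := by
  have h : (p : ℚ_[p]) = ((2 * n + 1 : ℕ) : ℚ_[p]) := congrArg _ hp
  rw [h]; push_cast; rfl

lemma isPUnit_two (hp : p = 2 * n + 1) : IsPUnit (2 : ℚ_[p]) := by
  have h := (Fact.out : p.Prime).two_le
  exact_mod_cast isPUnit_natCast_of_lt (p := p) (k := 2) (by omega) (by omega)

lemma isInt_half (hp : p = 2 * n + 1) : IsInt (1 / 2 : ℚ_[p]) := isInt_one.div (isPUnit_two hp)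

lemma isPUnit_half_add (hp : p = 2 * n + 1) {i : ℕ} (hi : i < n) :
    IsPUnit (1 / 2 + i : ℚ_[p]) := by
  have h := isPUnit_natCast_of_lt (p := p) (k := 2 * i + 1) (by omega) (by omega)
  have h2 := isPUnit_two hp
  have := h.div h2
  push_cast at this
  convert this using 1
  have := h2.ne_zero
  field_simp
  ring

lemma isPUnit_one_add {i : ℕ} (hi : i + 1 < p) : IsPUnit (1 + i : ℚ_[p]) := by
  have h := isPUnit_natCast_of_lt (p := p) (k := i + 1) (by omega) (by omega)
  push_cast at h
  rwa [add_comm]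

lemma isPUnit_poch_half (hp : p = 2 * n + 1) {k : ℕ} (hk : k ≤ n) :
    IsPUnit (poch (1 / 2 : ℚ_[p]) k) :=
  IsPUnit.prod fun i hi => isPUnit_half_add hp (by have := Finset.mem_range.1 hi; omega)

lemma isPUnit_poch_one {k : ℕ} (hk : k < p) : IsPUnit (poch (1 : ℚ_[p]) k) :=
  IsPUnit.prod fun i hi => isPUnit_one_add (by have := Finset.mem_range.1 hi; omega)

lemma exists_firstOrder_poch_half (hp : p = 2 * n + 1) {k : ℕ} (hk : k ≤ n) :
    ∃ σ : ℚ_[p], IsInt σ ∧ ∀ t : ℚ_[p], IsInt t →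
      FirstOrder (poch (1 / 2 + t * p : ℚ_[p]) k) (poch (1 / 2) k) (t * σ) := by
  obtain ⟨σ, hσ, h⟩ := exists_firstOrder_prod (fun i => (1 / 2 + i : ℚ_[p])) k
    fun i hi => isPUnit_half_add hp (by omega)
  refine ⟨σ, hσ, fun t ht => ?_⟩
  have e : poch (1 / 2 + t * p : ℚ_[p]) k = ∏ i ∈ Finset.range k, (1 / 2 + i + t * p : ℚ_[p]) :=
    Finset.prod_congr rfl fun i _ => by ring
  rw [e]
  exact h t ht

lemma exists_firstOrder_poch_one {k : ℕ} (hk : k < p) :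
    ∃ σ : ℚ_[p], IsInt σ ∧ ∀ t : ℚ_[p], IsInt t →
      FirstOrder (poch (1 + t * p : ℚ_[p]) k) (poch 1 k) (t * σ) := by
  obtain ⟨σ, hσ, h⟩ := exists_firstOrder_prod (fun i => (1 + i : ℚ_[p])) k
    fun i hi => isPUnit_one_add (by omega)
  refine ⟨σ, hσ, fun t ht => ?_⟩
  have e : poch (1 + t * p : ℚ_[p]) k = ∏ i ∈ Finset.range k, (1 + i + t * p : ℚ_[p]) :=
    Finset.prod_congr rfl fun i _ => by ring
  rw [e]
  exact h t ht

lemma neg_eq_half_add (hp : p = 2 * n + 1) : -(n : ℚ_[p]) = 1 / 2 + (-(1 / 2)) * p := by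
  rw [cast_p_eq hp]; ring

lemma succ_eq_half_add (hp : p = 2 * n + 1) : (n : ℚ_[p]) + 1 = 1 / 2 + 1 / 2 * p := by
  rw [cast_p_eq hp]; ring

/-- Since -n = 1/2 - p/2 and n + 1 = 1/2 + p/2, the two first-order terms are opposite and cancel.
-/
lemma poch_neg_mul_poch_succ_modEq (hp : p = 2 * n + 1) {k : ℕ} (hk : k ≤ n) :
    PadicModEq p 2 (poch (-(n : ℚ_[p])) k * poch ((n : ℚ_[p]) + 1) k)
      (poch (1 / 2) k ^ 2) := by
  obtain ⟨σ, _, h⟩ := exists_firstOrder_poch_half hp hk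
  have h2 := isInt_half hp
  have h1 := (h _ h2.neg).mul (h _ h2)
  rw [neg_eq_half_add hp, succ_eq_half_add hp]
  refine h1.3.trans (.of_eq (by ring))

lemma centralBinom_div_four_pow (k : ℕ) :
    (((2 * k).choose k : ℚ_[p])) / 4 ^ k = poch (1 / 2) k / poch 1 k := by
  induction k with
  | zero => simp
  | succ k ih =>
    have h := Nat.succ_mul_centralBinom_succ k
    simp only [Nat.centralBinom_eq_two_mul_choose] at h
    have h' : ((k : ℚ_[p]) + 1) * ((2 * (k + 1)).choose (k + 1) : ℚ_[p]) =
      2 * (2 * k + 1) * ((2 * k).choose k : ℚ_[p]) := by exact_mod_cast h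
    have h0 : (k : ℚ_[p]) + 1 ≠ 0 := by exact_mod_cast k.succ_ne_zero
    have h1 : 1 + (k : ℚ_[p]) ≠ 0 := by rwa [add_comm]
    have h2 := poch_one_ne_zero (K := ℚ_[p]) k
    rw [poch_succ, poch_succ]
    have e : ((2 * (k + 1)).choose (k + 1) : ℚ_[p]) / 4 ^ (k + 1) =
        (2 * k + 1) / (2 * (k + 1)) * (((2 * k).choose k : ℚ_[p]) / 4 ^ k) := by
      rw [pow_succ]
      field_simp
      linear_combination 2 * h'
    rw [e, ih]
    field_simp
    ring

lemma isInt_harmonic {k : ℕ} (hk : k < p) : IsInt ((harmonic k : ℚ) : ℚ_[p]) := by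
  have := (secondOrder_poch (p := p) isInt_one hk).2.1
  rwa [one_mul] at this

/-- The `k`-th summand, times `p`, as a central difference. -/
lemma summand_modEq (hp : p = 2 * n + 1) {k : ℕ} (hk : k ≤ n) (m : ℕ) :
    PadicModEq p 3
      (2 * (((n : ℚ_[p]) + 1 + 2 * k) * (poch (-n : ℚ_[p]) k * poch (n + 1 : ℚ_[p]) k * poch (1 / 2) k ^ m) /
        (poch 1 k * poch (1 + 1 * p : ℚ_[p]) k * poch (1 + 1 / 2 * p : ℚ_[p]) k ^ m) * ((-1) ^ m) ^ k) -
      2 * ((-(n : ℚ_[p]) + 2 * k) * (poch (-n : ℚ_[p]) k * poch (n + 1 : ℚ_[p]) k * poch (1 / 2) k ^ m) /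
        (poch 1 k * poch (1 - 1 * p : ℚ_[p]) k * poch (1 - 1 / 2 * p : ℚ_[p]) k ^ m) * ((-1) ^ m) ^ k))
      ((p : ℚ_[p]) * ((poch (1 / 2) k / poch 1 k) ^ (m + 2) *
        (2 - (m + 2) * (4 * (k : ℚ_[p]) + 1) * ((harmonic k : ℚ) : ℚ_[p])) * ((-1) ^ m) ^ k)) := by
  have hkp : k < p := by omega
  have hf := isPUnit_poch_one (p := p) hkp
  have hhalf := isInt_half hp
  have hw : IsInt (4 * (k : ℚ_[p]) + 1) :=
    ((isInt_ofNat 4).mul (isInt_natCast k)).add isInt_one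
  have hs : IsInt (((-1 : ℚ_[p]) ^ m) ^ k) := (isInt_one.neg.pow m).pow k
  have hN : IsInt (poch (1 / 2) k ^ m / poch 1 k * ((-1 : ℚ_[p]) ^ m) ^ k) :=
    (((isPUnit_poch_half hp hk).isInt.pow m).div hf).mul hs
  have hH := isInt_harmonic (p := p) hkp
  -- The denominators (1 ± p)_k (1 ± p/2)_k^m have first-order coefficient (1 + m/2) H_k. Inverting
  -- changes its sign, and the doubling in `central_difference` produces -(m + 2) H_k.
  have h1 := ((secondOrder_poch (p := p) isInt_one hkp).mul
    ((secondOrder_poch (p := p) hhalf hkp).pow m)).inv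
  have h2 := h1.central_difference hw
  have hcong := poch_neg_mul_poch_succ_modEq hp hk
  have hint : IsInt (poch (-(n : ℚ_[p])) k * poch ((n : ℚ_[p]) + 1) k) :=
    hcong.isInt ((isPUnit_poch_half hp hk).isInt.pow 2)
  have h3 := h2.const_mul (hN.mul hint)
  have hm : IsInt (2 - ((m : ℚ_[p]) + 2) * (4 * (k : ℚ_[p]) + 1) * ((harmonic k : ℚ) : ℚ_[p])) :=
    (isInt_ofNat 2).sub ((((isInt_natCast m).add (isInt_ofNat 2)).mul hw).mul hH)
  -- The central difference already carries a factor p, so replacing the common numerator by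
  -- (1/2)_k² modulo p² costs nothing modulo p³.
  have h4 := (hcong.mul_const ((hN.mul ((hf.mul (hf.pow m)).inv.isInt)).mul hm)).p_mul
  have hpe := cast_p_eq hp
  have e1 : 2 * ((n : ℚ_[p]) + 1 + 2 * k) = 4 * (k : ℚ_[p]) + 1 + p := by rw [hpe]; ring
  have e2 : 2 * (-(n : ℚ_[p]) + 2 * k) = 4 * (k : ℚ_[p]) + 1 - p := by rw [hpe]; ring
  refine ((PadicModEq.of_eq ?_).trans h3).trans ((PadicModEq.of_eq ?_).trans (h4.trans
    (PadicModEq.of_eq ?_)))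
  · rw [← e1, ← e2]
    simp only [div_eq_mul_inv, mul_inv]
    ring
  · ring
  · rw [div_pow]
    have := hf.ne_zero
    rw [pow_add, pow_add]
    field_simp

/-- Summands with index beyond `(p - 1) / 2` vanish modulo `p ^ 2`. -/
lemma summand_modEq_zero (hp : p = 2 * n + 1) {k : ℕ} (hk : n < k) (hkp : k < p) (m : ℕ)
    {x : ℚ_[p]} (hx : IsInt x) :
    PadicModEq p 2 ((poch (1 / 2) k / poch 1 k) ^ (m + 2) * x) 0 := by
  have h1 : p ∣ (2 * k).choose k := by
    have hpp : p.Prime := Fact.out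
    have := Nat.choose_mul_factorial_mul_factorial (n := 2 * k) (k := k) (by omega)
    have h2 : p ∣ (2 * k).factorial := hpp.dvd_factorial.2 (by omega)
    rw [← this] at h2
    have h3 : ¬ p ∣ k.factorial := fun h => by have := hpp.dvd_factorial.1 h; omega
    have h4 : ¬ p ∣ (2 * k - k).factorial := fun h => by have := hpp.dvd_factorial.1 h; omega
    rcases hpp.dvd_mul.1 h2 with h | h
    · exact (hpp.dvd_mul.1 h).resolve_right h3
    · exact absurd h h4
  obtain ⟨c, hc⟩ := h1
  rw [← centralBinom_div_four_pow, hc, modEq_iff]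
  have h4 : IsPUnit ((4 : ℚ_[p]) ^ k) := by
    have := ((isPUnit_two hp).pow 2).pow k
    norm_num at this; exact this
  refine ⟨((c : ℚ_[p]) / 4 ^ k) ^ 2 * ((p * c : ℕ) / 4 ^ k) ^ m * x,
    ((((isInt_natCast c).div h4).pow 2).mul (((isInt_natCast _).div h4).pow m)).mul hx, ?_⟩
  push_cast
  rw [pow_add]
  ring

lemma isPUnit_poch_half_shift (hp : p = 2 * n + 1) {t : ℚ_[p]} (ht : IsInt t) {k : ℕ}
    (hk : k ≤ n) : IsPUnit (poch (1 / 2 + t * p : ℚ_[p]) k) := by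
  obtain ⟨σ, _, h⟩ := exists_firstOrder_poch_half hp hk
  exact (h t ht).isPUnit (isPUnit_poch_half hp hk)

lemma sum_range_modEq (hn : n + 1 ≤ p) {f g : ℕ → ℚ_[p]} (hfg : ∀ k, f k = g k)
    (hf : ∀ k, n < k → k < p → PadicModEq p 2 (f k) 0) :
    PadicModEq p 2 (∑ k ∈ Finset.range p, f k) (∑ k ∈ Finset.range (n + 1), g k) := by
  have h := PadicModEq.sum (p := p) (n := 2) (s := Finset.Ico (n + 1) p) (f := f) (g := fun _ => 0)
    fun k hk => hf k (Finset.mem_Ico.1 hk).1 (Finset.mem_Ico.1 hk).2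
  rw [Finset.sum_const_zero] at h
  rw [← Finset.sum_range_add_sum_Ico f hn]
  have h' := (PadicModEq.refl 2 (∑ k ∈ Finset.range (n + 1), f k)).add h
  rw [add_zero] at h'
  exact h'.trans (.of_eq (Finset.sum_congr rfl fun k _ => hfg k))

/-- Reduction of the harmonic sums to well-poised hypergeometric sums. -/
theorem harmonic_sum_modEq (hp : p = 2 * n + 1) (m : ℕ) :
    PadicModEq p 3
      ((p : ℚ_[p]) * ∑ k ∈ Finset.range p, (((2 * k).choose k : ℚ_[p]) / 4 ^ k) ^ (m + 2) *
        (2 - (m + 2) * (4 * (k : ℚ_[p]) + 1) * ((harmonic k : ℚ) : ℚ_[p])) * ((-1) ^ m) ^ k)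
      (2 * ∑ k ∈ Finset.range (n + 1), ((n : ℚ_[p]) + 1 + 2 * k) *
        (poch (-n : ℚ_[p]) k * poch (n + 1 : ℚ_[p]) k * poch (1 / 2) k ^ m) /
        (poch 1 k * poch (1 + 1 * p : ℚ_[p]) k * poch (1 + 1 / 2 * p : ℚ_[p]) k ^ m) * ((-1) ^ m) ^ k) := by
  have hhalf := isInt_half hp
  have hz : ∑ k ∈ Finset.range (n + 1), (-(n : ℚ_[p]) + 2 * k) *
      (poch (-n : ℚ_[p]) k * poch (n + 1 : ℚ_[p]) k * poch (1 / 2) k ^ m) /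
        (poch 1 k * poch (1 - 1 * p : ℚ_[p]) k * poch (1 - 1 / 2 * p : ℚ_[p]) k ^ m) * ((-1) ^ m) ^ k = 0 := by
    have h1 : poch (-(n : ℚ_[p])) n ≠ 0 := by
      rw [neg_eq_half_add hp]; exact (isPUnit_poch_half_shift hp hhalf.neg le_rfl).ne_zero
    have h2 : poch ((n : ℚ_[p]) + 1) n ≠ 0 := by
      rw [succ_eq_half_add hp]; exact (isPUnit_poch_half_shift hp hhalf le_rfl).ne_zero
    have h3 := (isPUnit_poch_half hp (le_refl n)).ne_zero
    -- Take b = -n, c = n + 1, d = 1/2: the partners 1 - n - b, 1 - n - c, 1 - n - d are 1, 1 - p, 1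
    -- - p/2.
    rw [← sum_wellPoised_antisymm h1 h2 h3 m]
    refine Finset.sum_congr rfl fun k _ => ?_
    rw [show 1 - (n : ℚ_[p]) - -n = 1 by ring,
      show 1 - (n : ℚ_[p]) - (n + 1) = 1 - 1 * p by rw [cast_p_eq hp]; ring,
      show 1 - (n : ℚ_[p]) - 1 / 2 = 1 - 1 / 2 * p by rw [cast_p_eq hp]; ring]
    simp only [div_eq_mul_inv, mul_inv, mul_pow, inv_pow]
    ring
  have hsplit : PadicModEq p 2
      (∑ k ∈ Finset.range p, (((2 * k).choose k : ℚ_[p]) / 4 ^ k) ^ (m + 2) *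
        (2 - (m + 2) * (4 * (k : ℚ_[p]) + 1) * ((harmonic k : ℚ) : ℚ_[p])) * ((-1) ^ m) ^ k)
      (∑ k ∈ Finset.range (n + 1), (poch (1 / 2) k / poch 1 k) ^ (m + 2) *
        (2 - (m + 2) * (4 * (k : ℚ_[p]) + 1) * ((harmonic k : ℚ) : ℚ_[p])) * ((-1) ^ m) ^ k) := by
    refine sum_range_modEq (by omega) (fun k => by rw [centralBinom_div_four_pow])
      fun k hk hkp => ?_
    rw [mul_assoc, centralBinom_div_four_pow]
    have h4 : IsInt (4 * (k : ℚ_[p]) + 1) :=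
      ((isInt_ofNat 4).mul (isInt_natCast k)).add isInt_one
    have hm : IsInt ((m : ℚ_[p]) + 2) := (isInt_natCast m).add (isInt_ofNat 2)
    exact summand_modEq_zero hp hk hkp m (((isInt_ofNat 2).sub
      ((hm.mul h4).mul (isInt_harmonic hkp))).mul ((isInt_one.neg.pow m).pow k))
  refine hsplit.p_mul.trans ?_
  have := PadicModEq.sum (s := Finset.range (n + 1)) fun k hk =>
    summand_modEq hp (show k ≤ n by have := Finset.mem_range.1 hk; omega) m
  rw [Finset.sum_sub_distrib, ← Finset.mul_sum, ← Finset.mul_sum, ← Finset.mul_sum, hz, mul_zero,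
    sub_zero] at this
  exact this.symm

end Reduction

/-! ### Closed forms of the well-poised series and their values modulo p² -/

section ClosedForms

lemma poch_double {K : Type*} [Field K] [CharZero K] (x : K) (k : ℕ) :
    poch x (2 * k) = 4 ^ k * (poch (x / 2) k * poch ((x + 1) / 2) k) := by
  induction k with
  | zero => simp
  | succ k ih =>
    rw [show 2 * (k + 1) = 2 * k + 1 + 1 by ring, poch_succ, poch_succ, ih, poch_succ, poch_succ]
    push_cast
    ring

variable {p : ℕ} [Fact p.Prime] {n : ℕ}

lemma one_div_nat_two_add_ne_zero (m i : ℕ) : (1 + (m : ℚ_[p]) / 2 + i) ≠ 0 := by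
  have h : (1 + (m : ℚ_[p]) / 2 + i) = (((2 + m + 2 * i : ℕ)) : ℚ_[p]) / 2 := by push_cast; ring
  rw [h]
  exact div_ne_zero (by exact_mod_cast (by omega : 2 + m + 2 * i ≠ 0)) two_ne_zero

lemma succ_mul_poch (n : ℕ) :
    ((n : ℚ_[p]) + 1) * poch (1 + ((n : ℚ_[p]) + 1)) n =
      (2 * n + 1) * (poch 1 (2 * n) / poch 1 n) := by
  have h1 := poch_add (1 : ℚ_[p]) n (n + 1)
  have h2 := poch_succ_left (1 + n : ℚ_[p]) n
  have h3 := poch_succ (1 : ℚ_[p]) (2 * n)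
  rw [show n + (n + 1) = 2 * n + 1 by ring, h3, h2] at h1
  have h4 := poch_one_ne_zero (K := ℚ_[p]) n
  rw [add_comm 1 ((n : ℚ_[p]) + 1), add_comm (n : ℚ_[p]) 1]
  field_simp
  push_cast at h1
  linear_combination -h1

lemma poch_succ_self (n : ℕ) :
    poch ((n : ℚ_[p]) + 1) n = poch 1 (2 * n) / poch 1 n := by
  have h1 := poch_add (1 : ℚ_[p]) n n
  have h4 := poch_one_ne_zero (K := ℚ_[p]) n
  rw [two_mul, h1, add_comm (n : ℚ_[p]) 1]
  field_simp

/-- The quantity `(p - 1)! / (n! (1 + p / 2)_n)` with `p = 2 n + 1`. -/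
noncomputable def halfQuot (p : ℕ) [Fact p.Prime] (n : ℕ) : ℚ_[p] :=
  poch 1 (2 * n) / (poch 1 n * poch (1 + 1 / 2 * p : ℚ_[p]) n)

section

variable (hp : p = 2 * n + 1)
include hp

lemma param_ne_zero : (∀ i : ℕ, 1 + ((n : ℚ_[p]) + 1) + i ≠ 0) ∧
    (∀ i : ℕ, 1 + ((n : ℚ_[p]) + 1) - 1 / 2 + i ≠ 0) := by
  constructor
  · intro i
    exact_mod_cast (by omega : 1 + (n + 1) + i ≠ 0)
  · intro i
    have h := one_div_nat_two_add_ne_zero (p := p) p i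
    rw [cast_p_eq hp] at h
    convert h using 1
    ring

lemma param_half : 1 + ((n : ℚ_[p]) + 1) - 1 / 2 = 1 + 1 / 2 * p := by
  rw [cast_p_eq hp]; ring

lemma param_one : 1 + ((n : ℚ_[p]) + 1) + n = 1 + 1 * p := by
  rw [cast_p_eq hp]; ring

lemma wellPoised_closed_one :
    ∑ k ∈ Finset.range (n + 1), ((n : ℚ_[p]) + 1 + 2 * k) *
        (poch (-n : ℚ_[p]) k * poch (n + 1 : ℚ_[p]) k * poch (1 / 2) k ^ 1) /
        (poch 1 k * poch (1 + 1 * p : ℚ_[p]) k * poch (1 + 1 / 2 * p : ℚ_[p]) k ^ 1) *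
        ((-1) ^ 1) ^ k = p * halfQuot p n := by
  obtain ⟨h1, h2⟩ := param_ne_zero hp
  have h := sum_wellPoised_four ((n : ℚ_[p]) + 1) (1 / 2) h1 h2 n
  rw [param_half hp, param_one hp, succ_mul_poch] at h
  rw [halfQuot]
  have hpe := cast_p_eq hp
  calc _ = _ := Finset.sum_congr rfl fun k _ => by ring
    _ = _ := h
    _ = _ := by rw [← hpe]; simp only [div_eq_mul_inv, mul_inv]; ring

lemma wellPoised_closed_two :
    ∑ k ∈ Finset.range (n + 1), ((n : ℚ_[p]) + 1 + 2 * k) *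
        (poch (-n : ℚ_[p]) k * poch (n + 1 : ℚ_[p]) k * poch (1 / 2) k ^ 2) /
        (poch 1 k * poch (1 + 1 * p : ℚ_[p]) k * poch (1 + 1 / 2 * p : ℚ_[p]) k ^ 2) *
        ((-1) ^ 2) ^ k = p * halfQuot p n ^ 2 := by
  obtain ⟨h1, h2⟩ := param_ne_zero hp
  have h := sum_wellPoised_five ((n : ℚ_[p]) + 1) (1 / 2) (1 / 2) h1 h2 h2 n
  rw [show 1 + ((n : ℚ_[p]) + 1) - 1 / 2 - 1 / 2 = n + 1 by ring, param_half hp, param_one hp,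
    ← mul_assoc, succ_mul_poch, poch_succ_self] at h
  rw [halfQuot]
  have hpe := cast_p_eq hp
  calc _ = _ := Finset.sum_congr rfl fun k _ => by
        rw [show ((-1 : ℚ_[p]) ^ 2) ^ k = 1 by simp]; ring
    _ = _ := h
    _ = _ := by rw [← hpe]; simp only [div_eq_mul_inv, mul_inv]; ring

lemma wellPoised_closed_three :
    ∑ k ∈ Finset.range (n + 1), ((n : ℚ_[p]) + 1 + 2 * k) *
        (poch (-n : ℚ_[p]) k * poch (n + 1 : ℚ_[p]) k * poch (1 / 2) k ^ 3) /
        (poch 1 k * poch (1 + 1 * p : ℚ_[p]) k * poch (1 + 1 / 2 * p : ℚ_[p]) k ^ 3) *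
        ((-1) ^ 3) ^ k = p * (halfQuot p n * ∑ j ∈ Finset.range (n + 1),
          poch (n + 1 : ℚ_[p]) j * poch (1 / 2) j * poch (-n : ℚ_[p]) j /
          (poch 1 j * poch (1 + 1 / 2 * p : ℚ_[p]) j * poch (1 + 1 / 2 * p : ℚ_[p]) j)) := by
  obtain ⟨h1, h2⟩ := param_ne_zero hp
  have h := sum_wellPoised_six ((n : ℚ_[p]) + 1) (1 / 2) (1 / 2) (1 / 2) h1 h2 h2 h2 n
  rw [show 1 + ((n : ℚ_[p]) + 1) - 1 / 2 - 1 / 2 = n + 1 by ring, param_half hp, param_one hp,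
    succ_mul_poch] at h
  rw [halfQuot, ← mul_assoc]
  have hpe := cast_p_eq hp
  calc _ = _ := Finset.sum_congr rfl fun k _ => by
        rw [show (-1 : ℚ_[p]) ^ 3 = -1 by norm_num]; ring
    _ = _ := h
    _ = _ := by rw [← hpe]; simp only [div_eq_mul_inv, mul_inv]; ring

/-- `∏_{j < p} (j + t p) ≡ (p - 1)! (mod p ^ 2)`. -/
lemma poch_full_modEq {t : ℚ_[p]} (ht : IsInt t) :
    PadicModEq p 2 (poch (1 + t * p : ℚ_[p]) (2 * n)) (poch 1 (2 * n)) := by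
  obtain ⟨σ, hσ, h⟩ := exists_firstOrder_poch_one (p := p) (k := 2 * n) (by omega)
  -- At t = -1, reversal shows that the product equals (p - 1)! exactly. Hence p σ (p - 1)! ≡ 0 (mod
  -- p²), and the first-order term, being linear in t, vanishes for every t.
  have h1 := (h (-1) isInt_one.neg).3
  have h2 := poch_reflect (1 : ℚ_[p]) 0 (2 * n)
  rw [show 1 - ((0 + 2 * n : ℕ) : ℚ_[p]) - 1 = 1 + -1 * p by rw [cast_p_eq hp]; push_cast; ring] at h2
  have h3 : poch (1 + -1 * p : ℚ_[p]) (2 * n) = poch 1 (2 * n) := by simpa using h2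
  rw [h3] at h1
  have h4 := ((h1.const_mul ht).sub (PadicModEq.refl 2 (t * poch 1 (2 * n)))).neg
  refine (h t ht).3.trans ?_
  have h5 := h4.symm.add (PadicModEq.refl 2 (poch 1 (2 * n)))
  refine ((PadicModEq.of_eq ?_).trans h5).trans (.of_eq ?_) <;> ring

lemma isPUnit_four_pow : IsPUnit ((4 : ℚ_[p]) ^ n) := by
  have := ((isPUnit_two hp).pow 2).pow n
  norm_num at this; exact this

/-- Duplication splits (1 + p)_{2n} as 4^n (n + 1)_n (1 + p/2)_n. The left side is ≡ (2n)! and (n +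
1)_n = (2n)!/n!, which isolates the remaining factor. -/
lemma poch_one_add_half_modEq :
    PadicModEq p 2 (poch (1 + 1 / 2 * p : ℚ_[p]) n) (poch 1 n / 4 ^ n) := by
  have h1 := poch_double (1 + 1 * p : ℚ_[p]) n
  have h2 := poch_full_modEq hp (t := 1) isInt_one
  rw [h1, show (1 + 1 * (p : ℚ_[p])) / 2 = n + 1 by rw [cast_p_eq hp]; ring,
    show (1 + 1 * (p : ℚ_[p]) + 1) / 2 = 1 + 1 / 2 * p by ring, poch_succ_self] at h2
  have hu1 := isPUnit_poch_one (p := p) (k := 2 * n) (by omega)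
  have hu2 := isPUnit_poch_one (p := p) (k := n) (by omega)
  have hu3 := isPUnit_four_pow hp
  have h3 := h2.const_mul ((hu2.div (hu3.mul hu1)).isInt)
  have n1 := hu1.ne_zero
  have n2 := hu2.ne_zero
  have n3 := hu3.ne_zero
  refine ((PadicModEq.of_eq ?_).trans h3).trans (.of_eq ?_)
  · field_simp
  · field_simp

/-- The first-order terms of (1 + p/2)_n and (1 - p/2)_n are opposite, so their product is ≡ n!²;
divide by the value already found. -/
lemma poch_one_sub_half_modEq :
    PadicModEq p 2 (poch (1 - 1 / 2 * p : ℚ_[p]) n) (poch 1 n * 4 ^ n) := by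
  obtain ⟨σ, _, h⟩ := exists_firstOrder_poch_one (p := p) (k := n) (by omega)
  have hh := isInt_half hp
  have h1 := (h _ hh).mul (h _ hh.neg)
  have hu2 := isPUnit_poch_one (p := p) (k := n) (by omega)
  have hu3 := isPUnit_four_pow hp
  have h2 : PadicModEq p 2 (poch (1 + 1 / 2 * p : ℚ_[p]) n * poch (1 + -(1 / 2) * p : ℚ_[p]) n)
      (poch 1 n * poch 1 n) := h1.3.trans (.of_eq (by ring))
  have h3 := h2.div (poch_one_add_half_modEq hp) (hu2.mul hu2).isInt (hu2.div hu3)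
  have h4 := ((h _ hh).isPUnit hu2).ne_zero
  have n2 := hu2.ne_zero
  have n3 := hu3.ne_zero
  refine ((PadicModEq.of_eq ?_).trans h3).trans (.of_eq ?_)
  · rw [mul_div_cancel_left₀ _ h4]; congr 1; ring
  · field_simp

/-- Duplication and reversal give (2n)! = (-4)^n n! (1 - p/2)_n, so the quotient is (-4)^n (1 -
p/2)_n/(1 + p/2)_n, and the last ratio supplies two further factors 4^n. -/
lemma halfQuot_modEq : PadicModEq p 2 (halfQuot p n) ((-1) ^ n * (4 ^ n) ^ 3) := by
  have hu1 := isPUnit_poch_one (p := p) (k := n) (by omega)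
  have hu3 := isPUnit_four_pow hp
  have h1 : poch (1 : ℚ_[p]) (2 * n) =
      4 ^ n * ((-1) ^ n * poch (1 - 1 / 2 * p : ℚ_[p]) n * poch 1 n) := by
    have h2 := poch_reflect (1 / 2 : ℚ_[p]) 0 n
    rw [poch_zero, mul_one, zero_add,
      show 1 - (n : ℚ_[p]) - 1 / 2 = 1 - 1 / 2 * p by rw [cast_p_eq hp]; ring] at h2
    have h3 : (-1 : ℚ_[p]) ^ n * (-1) ^ n = 1 := by rw [← mul_pow]; simp
    rw [poch_double, h2, show (1 + 1 : ℚ_[p]) / 2 = 1 by norm_num]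
    linear_combination (-(4 : ℚ_[p]) ^ n * poch (1 / 2) n * poch 1 n) * h3
  have h2 := (poch_one_sub_half_modEq hp).const_mul ((hu3.mul (isPUnit_one.neg.pow n)).isInt)
  have h3 := h2.div (poch_one_add_half_modEq hp)
    ((hu3.mul (isPUnit_one.neg.pow n)).mul (hu1.mul hu3)).isInt (hu1.div hu3)
  have n1 := hu1.ne_zero
  have n3 := hu3.ne_zero
  have n4 := ((poch_one_add_half_modEq hp).isPUnit (hu1.div hu3)).ne_zero
  refine ((PadicModEq.of_eq ?_).trans h3).trans (.of_eq ?_)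
  · rw [halfQuot, h1]
    field_simp
  · field_simp

end

end ClosedForms

/-! ### Dixon's summation and its value modulo p² -/

section Dixon

/-- Dixon's terminating well-poised `₃F₂(1)` summation. -/
theorem sum_dixon {K : Type*} [Field K] [CharZero K] {a c : K} (ha : a ≠ 0)
    (hA : ∀ i : ℕ, 1 + a + i ≠ 0) (hb : ∀ i : ℕ, 1 + a / 2 + i ≠ 0)
    (hc : ∀ i : ℕ, 1 + a - c + i ≠ 0) (n : ℕ) :
    ∑ k ∈ Finset.range (n + 1), poch a k * poch c k * poch (-(n : K)) k /
        (poch 1 k * poch (1 + a - c) k * poch (1 + a + n) k) =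
      poch (1 + a) n * poch (1 + a / 2 - c) n / (poch (1 + a / 2) n * poch (1 + a - c) n) := by
  have e : 1 + a - a / 2 = 1 + a / 2 := by ring
  -- With b = a/2 the quotient (a/2)_k/(1 + a/2)_k is a/(a + 2k), which removes the very-well-poised
  -- factor.
  have h := sum_wellPoised_five a (a / 2) c hA (by rwa [e]) hc n
  rw [e] at h
  refine mul_left_cancel₀ ha ?_
  rw [Finset.mul_sum, ← mul_div_assoc, ← h]
  refine Finset.sum_congr rfl fun k _ => ?_
  have h1 := poch_ne_zero hb k
  have h2 : poch (a / 2) k * (a + 2 * k) = a * poch (1 + a / 2) k := by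
    have h3 := poch_succ (a / 2) k
    rw [poch_succ_left, add_comm (a / 2) 1] at h3
    linear_combination (-2 : K) * h3
  have h4 : a = poch (a / 2) k * (a + 2 * k) / poch (1 + a / 2) k := by
    rw [h2, mul_div_assoc, div_self h1, mul_one]
  simp only [div_eq_mul_inv, mul_inv] at h4 ⊢
  calc a * (poch a k * poch c k * poch (-(n : K)) k *
        ((poch 1 k)⁻¹ * (poch (1 + a - c) k)⁻¹ * (poch (1 + a + n) k)⁻¹))
      = (poch (a * 2⁻¹) k * (a + 2 * k) * (poch (1 + a * 2⁻¹) k)⁻¹) *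
        (poch a k * poch c k * poch (-(n : K)) k *
        ((poch 1 k)⁻¹ * (poch (1 + a - c) k)⁻¹ * (poch (1 + a + n) k)⁻¹)) := by rw [← h4]
    _ = _ := by ring

variable {p : ℕ} [Fact p.Prime] {n m : ℕ}

lemma cast_rat_ne_zero {x : ℚ_[p]} (q : ℚ) (hq : 0 < q) (h : x = q) : x ≠ 0 := by
  rw [h]; exact_mod_cast hq.ne'

/-- The right-hand side of Dixon's summation at `a = 1 / 2 + p / 3`, `c = 1 / 2 + p / 6`. -/
noncomputable def dixonQuot (p : ℕ) [Fact p.Prime] (n : ℕ) : ℚ_[p] :=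
  poch (3 / 2 + 1 / 3 * p : ℚ_[p]) n * poch (3 / 4) n /
    (poch (5 / 4 + 1 / 6 * p : ℚ_[p]) n * poch (1 + 1 / 6 * p : ℚ_[p]) n)

/-- The weights 1/3 and 1/6 are chosen so that the numerator shifts total 1/3 + 1/6 - 1/2 = 0 and
the denominator shifts 1/6 + 5/6 = 1, as in Whipple's ₃F₂, while the parameters remain well-poised.
They also make 1 + a/2 - c equal to 3/4 exactly. -/
lemma sum_dixon_special (hp : p = 2 * n + 1) :
    ∑ k ∈ Finset.range (n + 1), poch (1 / 2 + 1 / 3 * p : ℚ_[p]) k *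
        poch (1 / 2 + 1 / 6 * p : ℚ_[p]) k * poch (-n : ℚ_[p]) k /
        (poch 1 k * poch (1 + 1 / 6 * p : ℚ_[p]) k * poch (1 + 5 / 6 * p : ℚ_[p]) k) =
      dixonQuot p n := by
  have hP := cast_p_eq hp
  have e1 : 1 + (1 / 2 + 1 / 3 * (p : ℚ_[p])) - (1 / 2 + 1 / 6 * p) = 1 + 1 / 6 * p := by ring
  have e2 : 1 + (1 / 2 + 1 / 3 * (p : ℚ_[p])) + n = 1 + 5 / 6 * p := by rw [hP]; ring
  have e3 : 1 + (1 / 2 + 1 / 3 * (p : ℚ_[p])) / 2 - (1 / 2 + 1 / 6 * p) = 3 / 4 := by ring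
  have e4 : 1 + (1 / 2 + 1 / 3 * (p : ℚ_[p])) / 2 = 5 / 4 + 1 / 6 * p := by ring
  have e5 : 1 + (1 / 2 + 1 / 3 * (p : ℚ_[p])) = 3 / 2 + 1 / 3 * p := by ring
  have h := sum_dixon (a := (1 / 2 + 1 / 3 * p : ℚ_[p])) (c := (1 / 2 + 1 / 6 * p : ℚ_[p]))
    (cast_rat_ne_zero (1 / 2 + 1 / 3 * p) (by positivity) (by push_cast; ring))
    (fun i => cast_rat_ne_zero (1 + (1 / 2 + 1 / 3 * p) + i) (by positivity) (by push_cast; ring))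
    (fun i => cast_rat_ne_zero (1 + (1 / 2 + 1 / 3 * p) / 2 + i) (by positivity)
      (by push_cast; ring))
    (fun i => cast_rat_ne_zero (1 + 1 / 6 * p + i) (by positivity) (by push_cast; ring)) n
  rw [e1, e2, e3, e4, e5] at h
  rw [dixonQuot, ← h]

lemma isPUnit_three (hp3 : 3 < p) : IsPUnit (3 : ℚ_[p]) := by
  exact_mod_cast isPUnit_natCast_of_lt (p := p) (k := 3) (by omega) hp3

lemma isPUnit_twelve (hp : p = 2 * n + 1) (hp3 : 3 < p) : IsPUnit (12 : ℚ_[p]) := by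
  have h := (isPUnit_three hp3).mul ((isPUnit_two hp).mul (isPUnit_two hp))
  norm_num at h
  exact h

lemma isInt_div_twelve (hp : p = 2 * n + 1) (hp3 : 3 < p) (z : ℤ) {x : ℚ_[p]} (hx : x = z / 12) :
    IsInt x := by
  rw [hx]
  exact (isInt_intCast z).div (isPUnit_twelve hp hp3)

/-- The `₃F₂(1)` coming from Whipple's transformation agrees modulo `p ^ 2` with a Dixon sum. -/
lemma sum_modEq_dixonQuot (hp : p = 2 * n + 1) (hp3 : 3 < p) :
    PadicModEq p 2 (∑ j ∈ Finset.range (n + 1),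
      poch (n + 1 : ℚ_[p]) j * poch (1 / 2) j * poch (-n : ℚ_[p]) j /
      (poch 1 j * poch (1 + 1 / 2 * p : ℚ_[p]) j * poch (1 + 1 / 2 * p : ℚ_[p]) j))
      (dixonQuot p n) := by
  rw [← sum_dixon_special hp]
  refine PadicModEq.sum fun k hk => ?_
  have hk' : k ≤ n := by have := Finset.mem_range.1 hk; omega
  obtain ⟨σ, hσ, h⟩ := exists_firstOrder_poch_half hp hk'
  obtain ⟨τ, hτ, h'⟩ := exists_firstOrder_poch_one (p := p) (k := k) (by omega)
  have t2 := isInt_half hp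
  have t3 : IsInt (1 / 3 : ℚ_[p]) := isInt_div_twelve hp hp3 4 (by norm_num)
  have t6 : IsInt (1 / 6 : ℚ_[p]) := isInt_div_twelve hp hp3 2 (by norm_num)
  have t5 : IsInt (5 / 6 : ℚ_[p]) := isInt_div_twelve hp hp3 10 (by norm_num)
  have hu := isPUnit_poch_one (p := p) (k := k) (by omega)
  have z1 := h 0 isInt_zero
  have z2 := h' 0 isInt_zero
  rw [zero_mul, add_zero] at z1 z2
  have f1 := (((h _ t2).mul z1).mul (h _ t2.neg)).div ((z2.mul (h' _ t2)).mul (h' _ t2))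
    ((hu.mul hu).mul hu)
  have f2 := (((h _ t3).mul (h _ t6)).mul (h _ t2.neg)).div ((z2.mul (h' _ t6)).mul (h' _ t5))
    ((hu.mul hu).mul hu)
  rw [neg_eq_half_add hp, succ_eq_half_add hp]
  exact f1.eq f2 rfl (by ring)

lemma isPUnit_add_mul_p {x t : ℚ_[p]} (hx : IsPUnit x) (ht : IsInt t) : IsPUnit (x + t * (p : ℚ_[p])) := by
  have h : PadicModEq p (0 + 1) (x + t * (p : ℚ_[p])) x := modEq_iff.2 ⟨t, ht, by ring⟩
  exact h.isPUnit hx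

lemma isInt_poch {x : ℚ_[p]} (hx : IsInt x) (k : ℕ) : IsInt (poch x k) :=
  IsInt.prod fun i _ => hx.add (isInt_natCast i)

lemma isPUnit_poch_one_add {t : ℚ_[p]} (ht : IsInt t) {k : ℕ} (hk : k < p) :
    IsPUnit (poch (1 + t * p : ℚ_[p]) k) := by
  obtain ⟨τ, hτ, h'⟩ := exists_firstOrder_poch_one hk
  exact (h' t ht).isPUnit (isPUnit_poch_one hk)

/-- The numerator has the two factors 3/2 + p/3 + 2m = 5p/6 and 3/4 + m = p/4, while both
denominators are units. -/
lemma dixonQuot_modEq_zero (hm : p = 4 * m + 3) (hp3 : 3 < p) :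
    PadicModEq p 2 (dixonQuot p (2 * m + 1)) 0 := by
  have hp : p = 2 * (2 * m + 1) + 1 := by omega
  have hP : (p : ℚ_[p]) = 4 * m + 3 := by rw [cast_p_eq hp]; push_cast; ring
  have t3 : IsInt (1 / 3 : ℚ_[p]) := isInt_div_twelve hp hp3 4 (by norm_num)
  have t6 : IsInt (1 / 6 : ℚ_[p]) := isInt_div_twelve hp hp3 2 (by norm_num)
  have t5 : IsInt (5 / 6 : ℚ_[p]) := isInt_div_twelve hp hp3 10 (by norm_num)
  have t4 : IsInt (1 / 4 : ℚ_[p]) := isInt_div_twelve hp hp3 3 (by norm_num)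
  have t34 : IsInt (3 / 4 : ℚ_[p]) := isInt_div_twelve hp hp3 9 (by norm_num)
  have t32 : IsInt (3 / 2 : ℚ_[p]) := isInt_div_twelve hp hp3 18 (by norm_num)
  have u4 : IsPUnit (4 : ℚ_[p]) := by
    have := (isPUnit_two hp).mul (isPUnit_two hp); norm_num at this; exact this
  have hd1 : IsPUnit (poch (5 / 4 + 1 / 6 * p : ℚ_[p]) (2 * m + 1)) := by
    refine IsPUnit.prod fun i hi => ?_
    have hi' := Finset.mem_range.1 hi
    have h1 : IsPUnit (((5 + 4 * i : ℕ) : ℚ_[p]) / 4) := by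
      refine (isPUnit_natCast ?_).div u4
      rintro ⟨c, hc⟩
      -- Here 5 + 4i ≤ 8m + 5 < 2p, so the only multiple of p available is p itself, which is
      -- excluded because p ≡ 3 (mod 4).
      have : c < 2 := by
        by_contra h
        have : p * 2 ≤ p * c := Nat.mul_le_mul_left p (by omega)
        omega
      interval_cases c <;> omega
    convert isPUnit_add_mul_p h1 t6 using 1
    push_cast; ring
  have hd2 := isPUnit_poch_one_add (p := p) t6 (k := 2 * m + 1) (by omega)
  have h1 : poch (3 / 2 + 1 / 3 * p : ℚ_[p]) (2 * m + 1) =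
      poch (3 / 2 + 1 / 3 * p : ℚ_[p]) (2 * m) * (5 / 6 * p) := by
    rw [poch_succ, hP]; push_cast; ring
  have h2 : poch (3 / 4 : ℚ_[p]) (2 * m + 1) =
      poch (3 / 4 : ℚ_[p]) m * (1 / 4 * p) * poch (3 / 4 + (m + 1 : ℕ) : ℚ_[p]) m := by
    rw [show 2 * m + 1 = (m + 1) + m by ring, poch_add, poch_succ, hP]; ring
  rw [dixonQuot, modEq_iff]
  refine ⟨poch (3 / 2 + 1 / 3 * p : ℚ_[p]) (2 * m) * (5 / 6) * (poch (3 / 4 : ℚ_[p]) m * (1 / 4) *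
    poch (3 / 4 + (m + 1 : ℕ) : ℚ_[p]) m) / (poch (5 / 4 + 1 / 6 * p : ℚ_[p]) (2 * m + 1) *
    poch (1 + 1 / 6 * p : ℚ_[p]) (2 * m + 1)), ?_, ?_⟩
  · exact ((((isInt_poch (t32.add (t3.mul (isInt_natCast p))) _).mul t5).mul
      (((isInt_poch t34 m).mul t4).mul (isInt_poch (t34.add (isInt_natCast _)) m))).div
      (hd1.mul hd2))
  · rw [h1, h2]; ring

/-- For p = 4m + 1 one numerator factor, 3/2 + p/3 + (2m - 1) = 5p/6, and one denominator factor,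
5/4 + p/6 + (m - 1) = 5p/12, are divisible by p. Reversing both products exposes these factors so
that p cancels exactly; only then may one reduce modulo p². -/
lemma dixonQuot_eq (hp : p = 2 * (2 * m) + 1) (hp3 : 3 < p) :
    dixonQuot p (2 * m) = poch (3 / 4) (2 * m) * ((-1) ^ m *
      poch (1 + -(5 / 6) * p : ℚ_[p]) (2 * m)) / (poch (1 + -(5 / 12) * p : ℚ_[p]) m *
        poch (1 + 5 / 12 * p : ℚ_[p]) m * poch (1 + 1 / 6 * p : ℚ_[p]) (2 * m)) := by
  have hP : (p : ℚ_[p]) = 4 * m + 1 := by rw [cast_p_eq hp]; push_cast; ring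
  have hm0 : (m : ℚ_[p]) ≠ 0 := by exact_mod_cast (by omega : m ≠ 0)
  have hp0 : (p : ℚ_[p]) ≠ 0 := by exact_mod_cast (by omega : p ≠ 0)
  have s1 : (-1 : ℚ_[p]) ^ m * (-1) ^ m = 1 := by rw [← mul_pow]; simp
  have h12 := isPUnit_twelve hp hp3
  have t5 : IsInt (5 / 12 : ℚ_[p]) := isInt_div_twelve hp hp3 5 (by norm_num)
  have t6 : IsInt (1 / 6 : ℚ_[p]) := isInt_div_twelve hp hp3 2 (by norm_num)
  have u1 := (isPUnit_poch_one_add (p := p) t5.neg (k := m) (by omega)).ne_zero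
  have u2 := (isPUnit_poch_one_add (p := p) t5 (k := m) (by omega)).ne_zero
  have u3 := (isPUnit_poch_one_add (p := p) t6 (k := 2 * m) (by omega)).ne_zero
  have hmu : (m : ℚ_[p]) - 5 / 12 * p ≠ 0 := by
    have := (isPUnit_add_mul_p (isPUnit_natCast_of_lt (p := p) (k := m) (by omega) (by omega))
      t5.neg).ne_zero
    convert this using 1; ring
  have h1 : poch (3 / 2 + 1 / 3 * p : ℚ_[p]) (2 * m) * (2 * m - 5 / 6 * p) =
      -(5 / 6) * p * poch (1 + -(5 / 6) * p : ℚ_[p]) (2 * m) := by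
    have h := poch_reflect (3 / 2 + 1 / 3 * p : ℚ_[p]) 0 (2 * m)
    rw [poch_zero, mul_one, zero_add, pow_mul, neg_one_sq, one_pow, one_mul,
      show 1 - ((2 * m : ℕ) : ℚ_[p]) - (3 / 2 + 1 / 3 * p) = -(5 / 6) * p by
        rw [hP]; push_cast; ring] at h
    rw [← h, add_comm 1, ← poch_succ_left, poch_succ]
    push_cast; ring
  have h2 : poch (5 / 4 + 1 / 6 * p : ℚ_[p]) m * (m - 5 / 12 * p) =
      (-1) ^ m * (-(5 / 12) * p * poch (1 + -(5 / 12) * p : ℚ_[p]) m) := by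
    have h := poch_reflect (5 / 4 + 1 / 6 * p : ℚ_[p]) 0 m
    rw [poch_zero, mul_one, zero_add,
      show 1 - (m : ℚ_[p]) - (5 / 4 + 1 / 6 * p) = -(5 / 12) * p by rw [hP]; ring] at h
    rw [add_comm 1, ← poch_succ_left, poch_succ, h]
    linear_combination (-(m : ℚ_[p]) + 5 / 12 * p) * poch (5 / 4 + 1 / 6 * p : ℚ_[p]) m * s1
  have h3 : poch (5 / 4 + 1 / 6 * p : ℚ_[p]) (2 * m) =
      poch (5 / 4 + 1 / 6 * p : ℚ_[p]) m * poch (1 + 5 / 12 * p : ℚ_[p]) m := by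
    rw [two_mul, poch_add]
    congr 2; rw [hP]; ring
  have h4 : poch (3 / 2 + 1 / 3 * p : ℚ_[p]) (2 * m) =
      -(5 / 12) * p * poch (1 + -(5 / 6) * p : ℚ_[p]) (2 * m) / (m - 5 / 12 * p) := by
    rw [eq_div_iff hmu]; linear_combination h1 / 2
  have h5 : poch (5 / 4 + 1 / 6 * p : ℚ_[p]) m =
      (-1) ^ m * (-(5 / 12) * p * poch (1 + -(5 / 12) * p : ℚ_[p]) m) / (m - 5 / 12 * p) := by
    rw [eq_div_iff hmu]; exact h2
  rw [dixonQuot, h3, h4, h5]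
  have s2 : (-1 : ℚ_[p]) ^ m ≠ 0 := by simp
  rw [div_eq_div_iff (by
      refine mul_ne_zero (mul_ne_zero (div_ne_zero (mul_ne_zero s2 (mul_ne_zero
        (mul_ne_zero ?_ hp0) u1)) hmu) u2) u3
      norm_num) (mul_ne_zero (mul_ne_zero u1 u2) u3)]
  simp only [div_eq_mul_inv]
  linear_combination (-(-(5 * 12⁻¹) * (p : ℚ_[p]) * poch (1 + -(5 * 6⁻¹) * p : ℚ_[p]) (2 * m) *
    (m - 5 * 12⁻¹ * p)⁻¹ * poch (3 * 4⁻¹) (2 * m) * poch (1 + -(5 * 12⁻¹) * p : ℚ_[p]) m *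
    poch (1 + 5 * 12⁻¹ * p : ℚ_[p]) m * poch (1 + 1 * 6⁻¹ * p : ℚ_[p]) (2 * m))) * s1

/-- As 4m + 1 = p, the base point 1 - 3p/4 + 3m is exactly 1/4, and (1/4)_m reverses to (1 - p/4)_m
up to sign. -/
lemma poch_quarter_reflect (hp : p = 2 * (2 * m) + 1) :
    poch (1 + -(3 / 4) * p + (m + 2 * m : ℕ) : ℚ_[p]) m =
      (-1) ^ m * poch (1 + -(1 / 4) * p : ℚ_[p]) m := by
  have hP : (p : ℚ_[p]) = 4 * m + 1 := by rw [cast_p_eq hp]; push_cast; ring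
  have s1 : (-1 : ℚ_[p]) ^ m * (-1) ^ m = 1 := by rw [← mul_pow]; simp
  have h := poch_reflect (1 / 4 : ℚ_[p]) 0 m
  rw [poch_zero, mul_one, zero_add,
    show 1 - (m : ℚ_[p]) - 1 / 4 = 1 + -(1 / 4) * p by rw [hP]; ring] at h
  rw [h, show 1 + -(3 / 4) * (p : ℚ_[p]) + (m + 2 * m : ℕ) = 1 / 4 by rw [hP]; push_cast; ring]
  linear_combination (-poch (1 / 4 : ℚ_[p]) m) * s1

/-- Reflection modulo `p`: the products up to `m` and `3 m` for `p = 4 m + 1`. -/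
lemma poch_three_quarters_modEq (hp : p = 2 * (2 * m) + 1) (hp3 : 3 < p) :
    PadicModEq p 2 (poch (3 / 4 : ℚ_[p]) (2 * m)) ((-1) ^ m * poch 1 (2 * (2 * m)) /
      (poch (1 + -(1 / 4) * p : ℚ_[p]) m * poch (1 + -(3 / 4) * p : ℚ_[p]) m)) := by
  have hP : (p : ℚ_[p]) = 4 * m + 1 := by rw [cast_p_eq hp]; push_cast; ring
  have t4 : IsInt (1 / 4 : ℚ_[p]) := isInt_div_twelve hp hp3 3 (by norm_num)
  have t34 : IsInt (3 / 4 : ℚ_[p]) := isInt_div_twelve hp hp3 9 (by norm_num)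
  have u1 := isPUnit_poch_one_add (p := p) t4.neg (k := m) (by omega)
  have u2 := isPUnit_poch_one_add (p := p) t34.neg (k := m) (by omega)
  have s1 : (-1 : ℚ_[p]) ^ m * (-1) ^ m = 1 := by rw [← mul_pow]; simp
  have h1 : poch (3 / 4 : ℚ_[p]) (2 * m) = poch (1 + -(3 / 4) * p + m : ℚ_[p]) (2 * m) := by
    have h := poch_reflect (3 / 4 : ℚ_[p]) 0 (2 * m)
    rw [poch_zero, mul_one, zero_add, pow_mul, neg_one_sq, one_pow, one_mul,
      show 1 - ((2 * m : ℕ) : ℚ_[p]) - 3 / 4 = 1 + -(3 / 4) * p + m by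
        rw [hP]; push_cast; ring] at h
    exact h.symm
  have h2 := poch_quarter_reflect hp
  have h3 := poch_full_modEq hp t34.neg
  have h4 : poch (1 + -(3 / 4) * p : ℚ_[p]) (2 * (2 * m)) =
      poch (1 + -(3 / 4) * p : ℚ_[p]) m * poch (3 / 4 : ℚ_[p]) (2 * m) *
      ((-1) ^ m * poch (1 + -(1 / 4) * p : ℚ_[p]) m) := by
    -- The full product (1 - 3p/4)_{p-1} ≡ (p - 1)! is cut into pieces of lengths m, 2m, m; the
    -- middle one is the wanted (3/4)_{2m}.
    rw [show 2 * (2 * m) = m + 2 * m + m by ring, poch_add, poch_add, h1, h2]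
  rw [h4] at h3
  have h5 := h3.mul_const (c := (-1) ^ m * (poch (1 + -(1 / 4) * p : ℚ_[p]) m *
    poch (1 + -(3 / 4) * p : ℚ_[p]) m)⁻¹)
    ((isInt_one.neg.pow m).mul (u1.mul u2).inv.isInt)
  have n1 := u1.ne_zero
  have n2 := u2.ne_zero
  refine ((PadicModEq.of_eq ?_).trans h5).trans (.of_eq (by ring))
  rw [mul_inv]
  linear_combination (-poch (3 / 4 : ℚ_[p]) (2 * m)) * (s1 + (-1) ^ m * (-1) ^ m *
    (mul_inv_cancel₀ n1 + poch (1 + -(1 / 4) * p : ℚ_[p]) m *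
      (poch (1 + -(1 / 4) * p : ℚ_[p]) m)⁻¹ * mul_inv_cancel₀ n2))

/-- The value of the Dixon sum modulo `p ^ 2` when `p = 4 m + 1`. -/
lemma dixonQuot_modEq (hp : p = 2 * (2 * m) + 1) (hp3 : 3 < p) :
    PadicModEq p 2 (dixonQuot p (2 * m)) ((4 ^ (2 * m)) ^ 2 * poch 1 (2 * (2 * m)) /
      poch (1 + -(1 / 4) * p : ℚ_[p]) m ^ 4) := by
  have t2 := isInt_half hp
  have t4 : IsInt (1 / 4 : ℚ_[p]) := isInt_div_twelve hp hp3 3 (by norm_num)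
  have t34 : IsInt (3 / 4 : ℚ_[p]) := isInt_div_twelve hp hp3 9 (by norm_num)
  have t6 : IsInt (1 / 6 : ℚ_[p]) := isInt_div_twelve hp hp3 2 (by norm_num)
  have t56 : IsInt (5 / 6 : ℚ_[p]) := isInt_div_twelve hp hp3 10 (by norm_num)
  have t512 : IsInt (5 / 12 : ℚ_[p]) := isInt_div_twelve hp hp3 5 (by norm_num)
  have s1 : (-1 : ℚ_[p]) ^ m * (-1) ^ m = 1 := by rw [← mul_pow]; simp
  have hu := isPUnit_poch_one (p := p) (k := m) (by omega)
  have hv := isPUnit_poch_one (p := p) (k := 2 * m) (by omega)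
  have hg := isPUnit_four_pow hp
  obtain ⟨σ, _, h⟩ := exists_firstOrder_poch_one (p := p) (k := m) (by omega)
  obtain ⟨τ, _, h'⟩ := exists_firstOrder_poch_one (p := p) (k := 2 * m) (by omega)
  have q1 : PadicModEq p 2 (poch (1 + -(5 / 6) * p : ℚ_[p]) (2 * m) /
      poch (1 + 1 / 6 * p : ℚ_[p]) (2 * m)) ((4 ^ (2 * m)) ^ 2) := by
    -- Both ratios have total shift -1: -5/6 - 1/6 and -1/2 - 1/2. The second ratio has already been
    -- evaluated.
    have a1 := ((h' _ t56.neg).div (h' _ t6) hv).eq ((h' _ t2.neg).div (h' _ t2) hv) rfl (by ring)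
    have a2 := (poch_one_sub_half_modEq hp).div (poch_one_add_half_modEq hp)
      (hv.mul hg).isInt (hv.div hg)
    have n1 := hv.ne_zero
    have n2 := hg.ne_zero
    refine a1.trans (((PadicModEq.of_eq ?_).trans a2).trans (.of_eq ?_))
    · congr 2; ring
    · field_simp
  -- The shifts -1/4, -3/4, -5/12, 5/12 add up to -1 = 4 · (-1/4), so the four different products
  -- merge into one fourth power.
  have q2 : PadicModEq p 2 (poch (1 + -(1 / 4) * p : ℚ_[p]) m * poch (1 + -(3 / 4) * p : ℚ_[p]) m *
      (poch (1 + -(5 / 12) * p : ℚ_[p]) m * poch (1 + 5 / 12 * p : ℚ_[p]) m))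
      (poch (1 + -(1 / 4) * p : ℚ_[p]) m ^ 4) :=
    (((h _ t4.neg).mul (h _ t34.neg)).mul ((h _ t512.neg).mul (h _ t512))).eq
      ((h _ t4.neg).pow 4) (by ring) (by push_cast; ring)
  have u1 := isPUnit_poch_one_add (p := p) t4.neg (k := m) (by omega)
  have u2 := isPUnit_poch_one_add (p := p) t34.neg (k := m) (by omega)
  have u3 := isPUnit_poch_one_add (p := p) t512.neg (k := m) (by omega)
  have u4 := isPUnit_poch_one_add (p := p) t512 (k := m) (by omega)
  have u5 := isPUnit_poch_one_add (p := p) t6 (k := 2 * m) (by omega)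
  have hw := isPUnit_poch_one (p := p) (k := 2 * (2 * m)) (by omega)
  have q3 := (poch_three_quarters_modEq hp hp3).mul_of_isInt q1
    (((isInt_one.neg.pow m).mul hw.isInt).div (u1.mul u2)) (hg.pow 2).isInt
  have q4 := q3.mul_const (c := (-1) ^ m * (poch (1 + -(5 / 12) * p : ℚ_[p]) m *
    poch (1 + 5 / 12 * p : ℚ_[p]) m)⁻¹) ((isInt_one.neg.pow m).mul (u3.mul u4).inv.isInt)
  have q5 := (PadicModEq.refl 2 ((4 ^ (2 * m)) ^ 2 * poch (1 : ℚ_[p]) (2 * (2 * m)))).div q2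
    ((hg.pow 2).mul hw).isInt (u1.pow 4)
  rw [dixonQuot_eq hp hp3]
  refine ((PadicModEq.of_eq ?_).trans q4).trans ((PadicModEq.of_eq ?_).trans q5)
  · simp only [div_eq_mul_inv, mul_inv]; ring
  · simp only [div_eq_mul_inv, mul_inv]
    linear_combination ((4 ^ (2 * m)) ^ 2 * poch (1 : ℚ_[p]) (2 * (2 * m)) *
      (poch (1 + -(1 * 4⁻¹) * p : ℚ_[p]) m)⁻¹ * (poch (1 + -(3 * 4⁻¹) * p : ℚ_[p]) m)⁻¹ *
      (poch (1 + -(5 * 12⁻¹) * p : ℚ_[p]) m)⁻¹ * (poch (1 + 5 * 12⁻¹ * p : ℚ_[p]) m)⁻¹) * s1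

end Dixon

/-! ### Wilson's theorem modulo p^k and convergence of Morita's sequence -/

section Wilson

variable {p : ℕ} [Fact p.Prime]

/-- An odd p cannot divide both a - 1 and a + 1, so the whole power p^k must divide one of them. -/
lemma ZMod.eq_one_or_neg_one_of_sq_eq_one (hp2 : p ≠ 2) (k : ℕ) {u : ZMod (p ^ k)}
    (hu : u ^ 2 = 1) : u = 1 ∨ u = -1 := by
  have hpp : p.Prime := Fact.out
  have hpos : NeZero (p ^ k) := ⟨pow_ne_zero _ hpp.ne_zero⟩
  obtain ⟨a, rfl⟩ : ∃ a : ℤ, (a : ZMod (p ^ k)) = u := ⟨u.val, by simp⟩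
  have h1 : ((p ^ k : ℕ) : ℤ) ∣ (a - 1) * (a + 1) := by
    rw [← ZMod.intCast_zmod_eq_zero_iff_dvd]
    push_cast
    linear_combination hu
  push_cast at h1
  have hpi : Prime (p : ℤ) := Nat.prime_iff_prime_int.1 hpp
  by_cases h : (p : ℤ) ∣ a - 1
  · have h' : ¬ (p : ℤ) ∣ a + 1 := fun h' => by
      have h2 : (p : ℤ) ∣ 2 := by have := dvd_sub h' h; ring_nf at this; exact this
      have h3 : p ∣ 2 := by exact_mod_cast h2
      exact hp2 ((Nat.prime_dvd_prime_iff_eq hpp Nat.prime_two).1 h3)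
    left
    have h3 : IsCoprime ((p : ℤ) ^ k) (a + 1) :=
      IsCoprime.pow_left ((Prime.coprime_iff_not_dvd hpi).2 h')
    have h4 := h3.dvd_of_dvd_mul_right h1
    have h5 : ((a - 1 : ℤ) : ZMod (p ^ k)) = 0 := by
      rw [ZMod.intCast_zmod_eq_zero_iff_dvd]; exact_mod_cast h4
    push_cast at h5
    linear_combination h5
  · right
    have h3 : IsCoprime ((p : ℤ) ^ k) (a - 1) :=
      IsCoprime.pow_left ((Prime.coprime_iff_not_dvd hpi).2 h)
    have h4 := h3.dvd_of_dvd_mul_left h1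
    have h5 : ((a + 1 : ℤ) : ZMod (p ^ k)) = 0 := by
      rw [ZMod.intCast_zmod_eq_zero_iff_dvd]; exact_mod_cast h4
    push_cast at h5
    linear_combination h5

/-- Wilson's theorem modulo an odd prime power, over the unit group. -/
lemma prod_units_zmod_prime_pow (hp2 : p ≠ 2) (k : ℕ) [Fintype (ZMod (p ^ k))ˣ] :
    ∏ u : (ZMod (p ^ k))ˣ, u = -1 := by
  classical
  -- Pair u with its inverse. Only 1 and -1 are self-inverse: the factor 1 is harmless, and -1 is
  -- set aside.
  have h : ∏ u ∈ (Finset.univ.erase (-1) : Finset (ZMod (p ^ k))ˣ), u = 1 := by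
    refine Finset.prod_involution (fun u _ => u⁻¹) (by simp) ?_ ?_ (by simp)
    · intro u hu hne heq
      have h1 : (u : ZMod (p ^ k)) ^ 2 = 1 := by
        rw [pow_two]
        nth_rewrite 2 [← heq]
        simp
      rcases ZMod.eq_one_or_neg_one_of_sq_eq_one hp2 k h1 with h2 | h2
      · exact hne (Units.ext h2)
      · exact (Finset.mem_erase.1 hu).1 (Units.ext (by simpa using h2))
    · intro u hu
      rw [Finset.mem_erase] at hu ⊢
      refine ⟨fun h => hu.1 ?_, Finset.mem_univ _⟩
      rw [inv_eq_iff_eq_inv] at h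
      simpa using h
  rw [← Finset.mul_prod_erase Finset.univ (fun u => u) (Finset.mem_univ (-1)), h, mul_one]

lemma prod_coprime_zmod_prime_pow (hp2 : p ≠ 2) {k : ℕ} (hk : k ≠ 0) :
    ∏ j ∈ (Finset.range (p ^ k)).filter (fun j => Nat.Coprime j p), (j : ZMod (p ^ k)) = -1 := by
  classical
  have hpp : p.Prime := Fact.out
  have hpos : NeZero (p ^ k) := ⟨pow_ne_zero _ hpp.ne_zero⟩
  have h := congrArg (Units.coeHom (ZMod (p ^ k))) (prod_units_zmod_prime_pow hp2 k)
  rw [map_prod] at h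
  simp only [Units.coeHom_apply, Units.val_neg, Units.val_one] at h
  rw [← h]
  symm
  refine Finset.prod_bij (fun u _ => (u : ZMod (p ^ k)).val) ?_ ?_ ?_ ?_
  · intro u _
    rw [Finset.mem_filter, Finset.mem_range]
    refine ⟨ZMod.val_lt _, ?_⟩
    exact (Nat.coprime_pow_right_iff (Nat.pos_of_ne_zero hk) _ _).1 (ZMod.val_coe_unit_coprime u)
  · intro u _ v _ huv
    exact Units.ext (ZMod.val_injective _ huv)
  · intro j hj
    rw [Finset.mem_filter, Finset.mem_range] at hj
    refine ⟨ZMod.unitOfCoprime j (Nat.Coprime.pow_right k hj.2), Finset.mem_univ _, ?_⟩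
    rw [ZMod.coe_unitOfCoprime, ZMod.val_natCast, Nat.mod_eq_of_lt hj.1]
  · intro u _
    simp

/-- The reduction of Morita's sequence modulo `p ^ k` has period `p ^ k`. -/
lemma toZModPow_moritaSeq_add (hp2 : p ≠ 2) {k : ℕ} (hk : k ≠ 0) (n : ℕ) :
    PadicInt.toZModPow k (moritaSeq p (n + p ^ k)) = PadicInt.toZModPow k (moritaSeq p n) := by
  have hpp : p.Prime := Fact.out
  have hM : ∀ n, PadicInt.toZModPow k (moritaSeq p n) = (-1) ^ n *
      ∏ j ∈ (Finset.range n).filter (fun j => Nat.Coprime j p), (j : ZMod (p ^ k)) := fun n => by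
    simp [moritaSeq]
  simp only [hM]
  induction n with
  | zero =>
    -- Over one full period the product contributes -1 and the sign (-1)^(p^k) is -1, so the two
    -- cancel; this is why the definition carries the alternating sign.
    rw [zero_add, prod_coprime_zmod_prime_pow hp2 hk,
      Odd.neg_one_pow ((hpp.odd_of_ne_two hp2).pow)]
    simp
  | succ n ih =>
    rw [show n + 1 + p ^ k = n + p ^ k + 1 by ring, Finset.range_add_one, Finset.range_add_one,
      Finset.filter_insert, Finset.filter_insert]
    have hc : Nat.Coprime (n + p ^ k) p ↔ Nat.Coprime n p := by
      obtain ⟨j, rfl⟩ := Nat.exists_eq_succ_of_ne_zero hk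
      rw [pow_succ]
      exact Nat.coprime_add_mul_right_left n p (p ^ j)
    by_cases h : Nat.Coprime n p
    · rw [if_pos (hc.2 h), if_pos h, Finset.prod_insert (by simp), Finset.prod_insert (by simp),
        pow_succ, pow_succ]
      have h0 : ((n + p ^ k : ℕ) : ZMod (p ^ k)) = n := by
        rw [Nat.cast_add, ZMod.natCast_self, add_zero]
      rw [h0]
      linear_combination (-(n : ZMod (p ^ k))) * ih
    · rw [if_neg (fun h' => h (hc.1 h')), if_neg h, pow_succ, pow_succ]
      linear_combination (-1 : ZMod (p ^ k)) * ih

/-- Periodicity modulo every p^k makes the sequence uniformly continuous for the p-adic topology on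
ℕ; both the existence of the limit and its approximation by a single term follow from this bound. -/
lemma norm_moritaSeq_sub_le (hp2 : p ≠ 2) {k : ℕ} (hk : k ≠ 0) {a b : ℕ}
    (hab : a ≡ b [MOD p ^ k]) :
    ‖moritaSeq p a - moritaSeq p b‖ ≤ (p : ℝ) ^ (-k : ℤ) := by
  have key : ∀ a c, PadicInt.toZModPow k (moritaSeq p (a + c * p ^ k)) =
      PadicInt.toZModPow k (moritaSeq p a) := fun a c => by
    induction c with
    | zero => simp
    | succ c ih => rw [add_mul, one_mul, ← add_assoc, toZModPow_moritaSeq_add hp2 hk, ih]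
  have h : PadicInt.toZModPow k (moritaSeq p a) = PadicInt.toZModPow k (moritaSeq p b) := by
    rw [← Nat.mod_add_div' a (p ^ k), ← Nat.mod_add_div' b (p ^ k), key, key, hab]
  rw [PadicInt.norm_le_pow_iff_mem_span_pow, ← PadicInt.ker_toZModPow, RingHom.mem_ker, map_sub, h,
    sub_self]

lemma modEq_of_norm_sub_le {k a b : ℕ} {x : ℤ_[p]} (ha : ‖(a : ℤ_[p]) - x‖ ≤ (p : ℝ) ^ (-k : ℤ))
    (hb : ‖(b : ℤ_[p]) - x‖ ≤ (p : ℝ) ^ (-k : ℤ)) : a ≡ b [MOD p ^ k] := by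
  rw [PadicInt.norm_le_pow_iff_mem_span_pow, ← PadicInt.ker_toZModPow, RingHom.mem_ker, map_sub,
    sub_eq_zero, map_natCast] at ha hb
  exact (ZMod.natCast_eq_natCast_iff _ _ _).1 (ha.trans hb.symm)

lemma neBot_comap_natCast (x : ℤ_[p]) : NeBot (comap (fun n : ℕ => (n : ℤ_[p])) (𝓝 x)) := by
  rw [comap_neBot_iff]
  intro t ht
  obtain ⟨y, hy, n, rfl⟩ := mem_closure_iff_nhds.1 (PadicInt.denseRange_natCast (p := p) x) t ht
  exact ⟨n, hy⟩

/-- The limit defining the `p`-adic Gamma function exists. -/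
lemma tendsto_padicGamma (hp2 : p ≠ 2) (x : ℤ_[p]) :
    Tendsto (moritaSeq p) (comap (fun n : ℕ => (n : ℤ_[p])) (𝓝 x)) (𝓝 (padicGamma p x)) := by
  have hnb := neBot_comap_natCast x
  refine tendsto_nhds_limUnder ?_
  rw [← cauchy_map_iff_exists_tendsto, Metric.cauchy_iff]
  refine ⟨hnb.map _, fun ε hε => ?_⟩
  obtain ⟨k, hk⟩ := PadicInt.exists_pow_neg_lt p hε
  have hp1 : (1 : ℝ) ≤ p := by exact_mod_cast (Fact.out : p.Prime).one_le
  -- The exponent is raised to k + 1 because periodicity is only available for nonzero exponents.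
  have hk' : (p : ℝ) ^ (-((k + 1 : ℕ) : ℤ)) < ε := by
    refine lt_of_le_of_lt (zpow_le_zpow_right₀ hp1 ?_) hk
    push_cast; omega
  have hpos : (0 : ℝ) < (p : ℝ) ^ (-((k + 1 : ℕ) : ℤ)) :=
    zpow_pos (by linarith) _
  refine ⟨moritaSeq p '' {n : ℕ | ‖(n : ℤ_[p]) - x‖ ≤ (p : ℝ) ^ (-((k + 1 : ℕ) : ℤ))},
    image_mem_map (mem_comap.2 ⟨Metric.closedBall x _, Metric.closedBall_mem_nhds x hpos,
      fun n hn => by simpa [dist_eq_norm] using hn⟩), ?_⟩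
  rintro _ ⟨a, ha, rfl⟩ _ ⟨b, hb, rfl⟩
  rw [dist_eq_norm]
  exact lt_of_le_of_lt (norm_moritaSeq_sub_le hp2 k.succ_ne_zero (modEq_of_norm_sub_le ha hb)) hk'

/-- `Γ_p(x)` is congruent to the term of Morita's sequence at any natural number close to `x`. -/
lemma norm_padicGamma_sub_le (hp2 : p ≠ 2) {k : ℕ} (hk : k ≠ 0) {x : ℤ_[p]} {a : ℕ}
    (ha : ‖(a : ℤ_[p]) - x‖ ≤ (p : ℝ) ^ (-k : ℤ)) :
    ‖padicGamma p x - moritaSeq p a‖ ≤ (p : ℝ) ^ (-k : ℤ) := by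
  have hnb := neBot_comap_natCast x
  have hp0 : (0 : ℝ) < p := by exact_mod_cast (Fact.out : p.Prime).pos
  refine le_of_tendsto ((tendsto_padicGamma hp2 x).sub_const (moritaSeq p a)).norm ?_
  refine mem_comap.2 ⟨Metric.closedBall x _, Metric.closedBall_mem_nhds x (zpow_pos hp0 (-k : ℤ)),
    fun n hn => ?_⟩
  refine norm_moritaSeq_sub_le hp2 hk (modEq_of_norm_sub_le ?_ ha)
  simpa [dist_eq_norm] using hn

end Wilson

/-! ### Evaluation of Γ_p(1/4)⁴ modulo p² -/

section GammaQuarter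

variable {p : ℕ} [Fact p.Prime] {n m : ℕ}

lemma modEq_of_norm_sub_le_coe {k : ℕ} {x y : ℤ_[p]} (h : ‖x - y‖ ≤ (p : ℝ) ^ (-k : ℤ)) :
    PadicModEq p k (x : ℚ_[p]) y := by
  rw [PadicInt.norm_le_pow_iff_mem_span_pow, Ideal.mem_span_singleton] at h
  obtain ⟨z, hz⟩ := h
  exact ⟨z, by rw [← PadicInt.coe_sub, hz]; push_cast; rfl⟩

lemma norm_sub_le_of_modEq_coe {k : ℕ} {x y : ℤ_[p]} (h : PadicModEq p k (x : ℚ_[p]) y) :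
    ‖x - y‖ ≤ (p : ℝ) ^ (-k : ℤ) := by
  obtain ⟨z, hz⟩ := h
  rw [PadicInt.norm_le_pow_iff_mem_span_pow, Ideal.mem_span_singleton]
  exact ⟨z, PadicInt.ext (by push_cast; exact hz)⟩

/-- The integers prime to `p` in a block of consecutive integers starting at a multiple of `p`. -/
lemma prod_block (M s : ℕ) (hs : s < p) :
    ∏ i ∈ Finset.range (s + 1), (if Nat.Coprime (p * M + i) p then ((p * M + i : ℕ) : ℚ_[p]) else 1) =
      poch (1 + M * p : ℚ_[p]) s := by
  have hpp : p.Prime := Fact.out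
  rw [Finset.prod_range_succ', if_neg, mul_one]
  · refine Finset.prod_congr rfl fun i hi => ?_
    have hi' := Finset.mem_range.1 hi
    rw [if_pos]
    · push_cast; ring
    · rw [Nat.coprime_mul_left_add_left, Nat.coprime_comm, hpp.coprime_iff_not_dvd]
      exact Nat.not_dvd_of_pos_of_lt (Nat.succ_pos i) (by omega)
  · rw [Nat.coprime_mul_left_add_left, Nat.coprime_zero_left]
    exact hpp.one_lt.ne'

lemma coe_moritaSeq (N : ℕ) : ((moritaSeq p N : ℤ_[p]) : ℚ_[p]) = (-1) ^ N *
    ∏ j ∈ Finset.range N, (if Nat.Coprime j p then (j : ℚ_[p]) else 1) := by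
  rw [moritaSeq, Finset.prod_filter, PadicInt.coe_mul, PadicInt.coe_pow, PadicInt.coe_neg,
    PadicInt.coe_one]
  congr 1
  refine (map_prod (PadicInt.Coe.ringHom (p := p)) _ _).trans ?_
  refine Finset.prod_congr rfl fun j _ => ?_
  split_ifs
  · exact map_natCast _ j
  · exact map_one _

/-- The block starting at jp contributes (1 + jp)_{p-1}, which is ≡ (p - 1)! whatever j is. -/
lemma prod_coprime_mul_modEq (hp : p = 2 * n + 1) (M : ℕ) :
    PadicModEq p 2 (∏ j ∈ Finset.range (p * M), (if Nat.Coprime j p then (j : ℚ_[p]) else 1))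
      (poch 1 (2 * n) ^ M) := by
  induction M with
  | zero => exact .of_eq (by simp)
  | succ M ih =>
    have h := prod_block (p := p) M (2 * n) (by omega)
    rw [show Finset.range (2 * n + 1) = Finset.range p by rw [← hp]] at h
    rw [mul_add, mul_one, Finset.prod_range_add, h, pow_succ]
    have hw := (isPUnit_poch_one (p := p) (k := 2 * n) (by omega)).isInt
    exact ih.mul_of_isInt (poch_full_modEq hp (isInt_natCast M)) (hw.pow M) hw

/-- `Γ_p(1 / 4)` modulo `p ^ 2`, up to sign, for `p = 4 m + 1`. -/
lemma padicGamma_quarter_modEq (hp : p = 2 * (2 * m) + 1) (hp3 : 3 < p) :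
    ∃ s : ℚ_[p], s ^ 2 = 1 ∧ PadicModEq p 2
      ((padicGamma p (PadicInt.inv 4) : ℤ_[p]) : ℚ_[p])
      (s * (poch 1 (2 * (2 * m)) ^ (3 * m + 1) / poch (1 + -(1 / 4) * p : ℚ_[p]) m)) := by
  have hP : (p : ℚ_[p]) = 4 * m + 1 := by rw [cast_p_eq hp]; push_cast; ring
  have t4 : IsInt (1 / 4 : ℚ_[p]) := isInt_div_twelve hp hp3 3 (by norm_num)
  have t34 : IsInt (3 / 4 : ℚ_[p]) := isInt_div_twelve hp hp3 9 (by norm_num)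
  have u1 := isPUnit_poch_one_add (p := p) t4.neg (k := m) (by omega)
  have n1 := u1.ne_zero
  have hw := isPUnit_poch_one (p := p) (k := 2 * (2 * m)) (by omega)
  have s1 : (-1 : ℚ_[p]) ^ m * (-1) ^ m = 1 := by rw [← mul_pow]; simp
  have hinv : ((PadicInt.inv (4 : ℤ_[p]) : ℤ_[p]) : ℚ_[p]) = 1 / 4 := by
    have h4 : ‖(4 : ℤ_[p])‖ = 1 := by
      have : IsPUnit (4 : ℚ_[p]) := by
        have := (isPUnit_two hp).mul (isPUnit_two hp); norm_num at this; exact this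
      exact this
    have h := congrArg (fun z : ℤ_[p] => (z : ℚ_[p])) (PadicInt.mul_inv h4)
    simp only [PadicInt.coe_mul, PadicInt.coe_one] at h
    have h' : (4 : ℚ_[p]) * ((PadicInt.inv (4 : ℤ_[p]) : ℤ_[p]) : ℚ_[p]) = 1 := h
    rw [eq_div_iff (by norm_num)]; linear_combination h'
  -- N = 3m(p + 1) + 1 satisfies N - 1/4 = 3p²/4. It consists of 3m full blocks of length p and a
  -- last partial block of 3m + 1 integers, the first of which is a multiple of p.
  set N := p * (3 * m) + (3 * m + 1) with hN
  have hx : PadicModEq p 2 (((N : ℕ) : ℤ_[p]) : ℚ_[p]) ((PadicInt.inv (4 : ℤ_[p]) : ℤ_[p]) : ℚ_[p]) := by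
    rw [hinv, modEq_iff]
    refine ⟨3 / 4, t34, ?_⟩
    rw [PadicInt.coe_natCast, hN]; push_cast; rw [hP]; ring
  have hΓ := modEq_of_norm_sub_le_coe (norm_padicGamma_sub_le (by omega) two_ne_zero
    (norm_sub_le_of_modEq_coe hx))
  rw [coe_moritaSeq, hN, Finset.prod_range_add, prod_block _ _ (by omega)] at hΓ
  have h1 := prod_coprime_mul_modEq hp (3 * m)
  -- Since 3m = 3p/4 - 3/4, replacing 3m by -3/4 changes each factor by exactly 3p²/4.
  have h2 : PadicModEq p 2 (poch (1 + (3 * m : ℕ) * p : ℚ_[p]) (3 * m))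
      (poch (1 + -(3 / 4) * p : ℚ_[p]) (3 * m)) := by
    have hi : ∀ i : ℕ, IsInt (1 + -(3 / 4) * p + i : ℚ_[p]) := fun i =>
      (isInt_one.add (t34.neg.mul (isInt_natCast p))).add (isInt_natCast i)
    refine PadicModEq.prod (fun i _ => ?_) fun i _ => hi i
    rw [modEq_iff]
    refine ⟨3 / 4, t34, ?_⟩
    push_cast; rw [hP]; ring
  have h3 : PadicModEq p 2 (poch (1 + -(3 / 4) * p : ℚ_[p]) (3 * m))
      ((-1) ^ m * (poch 1 (2 * (2 * m)) / poch (1 + -(1 / 4) * p : ℚ_[p]) m)) := by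
    have h4 := poch_full_modEq hp t34.neg
    rw [show 2 * (2 * m) = m + 2 * m + m by ring, poch_add, poch_quarter_reflect hp,
      show m + 2 * m = 3 * m by ring] at h4
    have h5 := h4.mul_const (c := (-1) ^ m * (poch (1 + -(1 / 4) * p : ℚ_[p]) m)⁻¹)
      ((isInt_one.neg.pow m).mul u1.inv.isInt)
    rw [show 3 * m + m = 2 * (2 * m) by ring] at h5
    refine ((PadicModEq.of_eq ?_).trans h5).trans (.of_eq ?_)
    · linear_combination (-poch (1 + -(3 / 4) * p : ℚ_[p]) (3 * m)) *
        (s1 + (-1) ^ m * (-1) ^ m * mul_inv_cancel₀ n1)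
    · rw [div_eq_mul_inv]; ring
  have hi3 : IsInt ((-1) ^ m * (poch 1 (2 * (2 * m)) / poch (1 + -(1 / 4) * p : ℚ_[p]) m)) :=
    (isInt_one.neg.pow m).mul (hw.isInt.div u1)
  have h6 := (h1.mul_of_isInt (h2.trans h3) (hw.pow _).isInt hi3).const_mul
    (isInt_one.neg.pow (p * (3 * m) + (3 * m + 1)))
  refine ⟨(-1) ^ (p * (3 * m) + (3 * m + 1)) * (-1) ^ m, ?_, hΓ.trans (h6.trans (.of_eq ?_))⟩
  · rw [mul_pow, ← pow_mul, ← pow_mul, mul_comm _ 2, mul_comm m 2, pow_mul, pow_mul]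
    simp
  · rw [pow_succ (poch (1 : ℚ_[p]) (2 * (2 * m))) (3 * m)]; ring

/-- `(p - 1)!` to the power `3 p + 1` is `-(p - 1)!` modulo `p ^ 2`. -/
lemma factorial_pow_modEq (hp : p = 2 * (2 * m) + 1) :
    PadicModEq p 2 (poch (1 : ℚ_[p]) (2 * (2 * m)) ^ (3 * p + 1)) (-poch 1 (2 * (2 * m))) := by
  have hodd : Odd p := ⟨2 * m, hp⟩
  have h1 : (p : ℤ) ∣ ((2 * (2 * m)).factorial : ℤ) - (-1) := by
    rw [← ZMod.intCast_zmod_eq_zero_iff_dvd]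
    have := ZMod.wilsons_lemma p
    rw [show p - 1 = 2 * (2 * m) by omega] at this
    push_cast
    rw [this]; ring
  -- Raising Wilson's congruence modulo p to the p-th power lifts it to a congruence modulo p².
  have h2 := dvd_sub_pow_of_dvd_sub h1 1
  rw [pow_one, hodd.neg_one_pow] at h2
  obtain ⟨c, hc⟩ := h2
  have h3 : PadicModEq p 2 (poch (1 : ℚ_[p]) (2 * (2 * m)) ^ p) (-1) := by
    rw [modEq_iff]
    refine ⟨c, isInt_intCast c, ?_⟩
    rw [poch_one]
    exact_mod_cast hc
  have hw := isPUnit_poch_one (p := p) (k := 2 * (2 * m)) (by omega)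
  have h4 := (h3.pow isInt_one.neg 3).mul_const hw.isInt
  refine ((PadicModEq.of_eq ?_).trans h4).trans (.of_eq (by ring))
  rw [pow_succ, mul_comm 3 p, pow_mul]

/-- `Γ_p(1 / 4) ^ 4` modulo `p ^ 2` for `p = 4 m + 1`. -/
lemma padicGamma_quarter_pow_modEq (hp : p = 2 * (2 * m) + 1) (hp3 : 3 < p) :
    PadicModEq p 2 (((padicGamma p (PadicInt.inv 4) : ℤ_[p]) : ℚ_[p]) ^ 4)
      (-(poch 1 (2 * (2 * m)) / poch (1 + -(1 / 4) * p : ℚ_[p]) m ^ 4)) := by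
  obtain ⟨s, hs, h⟩ := padicGamma_quarter_modEq hp hp3
  have t4 : IsInt (1 / 4 : ℚ_[p]) := isInt_div_twelve hp hp3 3 (by norm_num)
  have u1 := isPUnit_poch_one_add (p := p) t4.neg (k := m) (by omega)
  have hw := isPUnit_poch_one (p := p) (k := 2 * (2 * m)) (by omega)
  have hsi : IsInt s := by
    rw [isInt_iff]
    have : ‖s‖ ^ 2 = 1 := by rw [← norm_pow, hs, norm_one]
    exact ((pow_eq_one_iff_of_nonneg (norm_nonneg s) two_ne_zero).1 this).le
  have h1 := h.pow (hsi.mul ((hw.isInt.pow _).div u1)) 4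
  have h2 := (factorial_pow_modEq hp).mul_const (u1.pow 4).inv.isInt
  refine h1.trans (((PadicModEq.of_eq ?_).trans h2).trans (.of_eq (by rw [div_eq_mul_inv]; ring)))
  -- The fourth power removes the undetermined sign s and raises (p - 1)! to 4(3m + 1) = 3p + 1, the
  -- exponent handled by `factorial_pow_modEq`.
  rw [show 3 * p + 1 = (3 * m + 1) * 4 by omega, mul_pow, div_pow, ← pow_mul,
    show s ^ 4 = (s ^ 2) ^ 2 by ring, hs]
  rw [div_eq_mul_inv]; ring

end GammaQuarter

/-! ### Assembly of the congruences -/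

section Main

variable {p : ℕ} [Fact p.Prime] {n m : ℕ}

lemma harmonic_sum_modEq_one (hp : p = 2 * n + 1) :
    PadicModEq p 2 (∑ k ∈ Finset.range p, (((2 * k).choose k : ℚ_[p]) / 4 ^ k) ^ (1 + 2) *
        (2 - ((1 : ℕ) + 2) * (4 * (k : ℚ_[p]) + 1) * ((harmonic k : ℚ) : ℚ_[p])) * ((-1) ^ 1) ^ k)
      (2 * ((-1) ^ n * (4 ^ n) ^ 3)) := by
  have h := harmonic_sum_modEq hp 1
  rw [wellPoised_closed_one hp, mul_left_comm] at h
  exact h.of_p_mul.trans ((halfQuot_modEq hp).const_mul (isInt_ofNat 2))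

lemma isInt_halfQuot_bound (hp : p = 2 * n + 1) : IsInt ((-1 : ℚ_[p]) ^ n * (4 ^ n) ^ 3) :=
  (isInt_one.neg.pow n).mul ((isPUnit_four_pow hp).isInt.pow 3)

lemma harmonic_sum_modEq_two (hp : p = 2 * n + 1) :
    PadicModEq p 2 (∑ k ∈ Finset.range p, (((2 * k).choose k : ℚ_[p]) / 4 ^ k) ^ (2 + 2) *
        (2 - ((2 : ℕ) + 2) * (4 * (k : ℚ_[p]) + 1) * ((harmonic k : ℚ) : ℚ_[p])) * ((-1) ^ 2) ^ k)
      (2 * (4 ^ n) ^ 6) := by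
  have h := harmonic_sum_modEq hp 2
  rw [wellPoised_closed_two hp, mul_left_comm] at h
  refine h.of_p_mul.trans ((((halfQuot_modEq hp).pow (isInt_halfQuot_bound hp) 2).const_mul
    (isInt_ofNat 2)).trans (.of_eq ?_))
  rw [mul_pow, ← pow_mul (-1 : ℚ_[p]), mul_comm n 2, pow_mul (-1 : ℚ_[p])]
  ring

/-- The Dixon value is left as a parameter D, so that one argument serves both residue classes of p
modulo 4. -/
lemma harmonic_sum_modEq_three (hp : p = 2 * n + 1) (hp3 : 3 < p) {D : ℚ_[p]} (hD : IsInt D)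
    (h : PadicModEq p 2 (dixonQuot p n) D) :
    PadicModEq p 2 (∑ k ∈ Finset.range p, (((2 * k).choose k : ℚ_[p]) / 4 ^ k) ^ (3 + 2) *
        (2 - ((3 : ℕ) + 2) * (4 * (k : ℚ_[p]) + 1) * ((harmonic k : ℚ) : ℚ_[p])) * ((-1) ^ 3) ^ k)
      (2 * ((-1) ^ n * (4 ^ n) ^ 3 * D)) := by
  have h1 := harmonic_sum_modEq hp 3
  rw [wellPoised_closed_three hp, mul_left_comm] at h1
  exact h1.of_p_mul.trans (((halfQuot_modEq hp).mul_of_isInt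
    ((sum_modEq_dixonQuot hp hp3).trans h) (isInt_halfQuot_bound hp) hD).const_mul (isInt_ofNat 2))

/-- `2 ^ (p - 1) = 1 + p q_p(2)` as a first-order expansion. -/
lemma firstOrder_four_pow (hp : p = 2 * n + 1) :
    FirstOrder ((4 : ℚ_[p]) ^ n) 1 ((fermatQuotient p 2 : ℚ) : ℚ_[p]) := by
  have hpp : p.Prime := Fact.out
  have h2 : ¬ p ∣ 2 := fun h => by
    have := (Nat.prime_dvd_prime_iff_eq hpp Nat.prime_two).1 h; omega
  have h1 : (p : ℤ) ∣ 2 ^ (p - 1) - 1 := by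
    rw [← ZMod.intCast_zmod_eq_zero_iff_dvd]
    push_cast
    rw [ZMod.pow_card_sub_one_eq_one, sub_self]
    intro h0
    apply h2
    rw [← ZMod.natCast_eq_zero_iff]
    exact_mod_cast h0
  obtain ⟨c, hc⟩ := h1
  have hp0 : (p : ℚ) ≠ 0 := by exact_mod_cast hpp.ne_zero
  have hq : fermatQuotient p 2 = c := by
    rw [fermatQuotient, div_eq_iff hp0]
    push_cast
    have : ((2 : ℚ) ^ (p - 1) - 1) = p * c := by exact_mod_cast hc
    rw [this]; ring
  rw [hq]
  refine ⟨isInt_one, by simpa using isInt_intCast c, .of_eq ?_⟩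
  have : ((2 : ℚ_[p]) ^ (p - 1) - 1) = p * c := by exact_mod_cast hc
  rw [show p - 1 = 2 * n by omega, pow_mul] at this
  norm_num at this ⊢
  linear_combination this

lemma four_pow_pow_modEq (hp : p = 2 * n + 1) (k : ℕ) :
    PadicModEq p 2 (((4 : ℚ_[p]) ^ n) ^ k)
      (1 + k * p * ((fermatQuotient p 2 : ℚ) : ℚ_[p])) :=
  ((firstOrder_four_pow hp).pow k).3.trans (.of_eq (by ring))

lemma cast_sum_eq (r m : ℕ) (b : ℚ) (hr : r = m + 2) (hb : b = 4 ^ r) :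
    ((∑ k ∈ Finset.range p, ((2 * k).choose k : ℚ) ^ r / b ^ k *
      (2 - r * (4 * (k : ℚ) + 1) * harmonic k) * ((-1) ^ m) ^ k : ℚ) : ℚ_[p]) =
    ∑ k ∈ Finset.range p, (((2 * k).choose k : ℚ_[p]) / 4 ^ k) ^ (m + 2) *
        (2 - (m + 2) * (4 * (k : ℚ_[p]) + 1) * ((harmonic k : ℚ) : ℚ_[p])) * ((-1) ^ m) ^ k := by
  subst hr hb
  push_cast
  refine Finset.sum_congr rfl fun k _ => ?_
  rw [div_pow, ← pow_mul (4 : ℚ_[p]), ← pow_mul (4 : ℚ_[p]), mul_comm k (m + 2)]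

theorem mainTheorem5 (p : ℕ) [Fact p.Prime] (hp : 3 < p) :
    PadicModEq p 2
      ((∑ k ∈ Finset.range p, ((2 * k).choose k : ℚ) ^ 3 / 64 ^ k *
          (2 - 3 * (4 * (k : ℚ) + 1) * harmonic k) * (-1) ^ k : ℚ) : ℚ_[p])
      (((-1) ^ ((p - 1) / 2) * (2 + 6 * (p : ℚ) * fermatQuotient p 2) : ℚ) : ℚ_[p]) ∧
    PadicModEq p 2
      ((∑ k ∈ Finset.range p, ((2 * k).choose k : ℚ) ^ 4 / 256 ^ k *
          (2 - 4 * (4 * (k : ℚ) + 1) * harmonic k) : ℚ) : ℚ_[p])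
      ((2 + 12 * (p : ℚ) * fermatQuotient p 2 : ℚ) : ℚ_[p]) ∧
    (p % 4 = 1 →
      PadicModEq p 2
        ((∑ k ∈ Finset.range p, ((2 * k).choose k : ℚ) ^ 5 / 1024 ^ k *
            (2 - 5 * (4 * (k : ℚ) + 1) * harmonic k) * (-1) ^ k : ℚ) : ℚ_[p])
        (-((2 + 10 * (p : ℚ) * fermatQuotient p 2 : ℚ) : ℚ_[p]) *
          ((padicGamma p (PadicInt.inv 4) : ℤ_[p]) : ℚ_[p]) ^ 4)) ∧
    (p % 4 = 3 →
      PadicModEq p 2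
        ((∑ k ∈ Finset.range p, ((2 * k).choose k : ℚ) ^ 5 / 1024 ^ k *
            (2 - 5 * (4 * (k : ℚ) + 1) * harmonic k) * (-1) ^ k : ℚ) : ℚ_[p])
        0) := by
  have hodd : Odd p := (Fact.out : p.Prime).odd_of_ne_two (by omega)
  obtain ⟨n, hn⟩ := hodd
  have hg := isPUnit_four_pow hn
  have e3 := cast_sum_eq (p := p) 3 1 64 rfl (by norm_num)
  have e4 := cast_sum_eq (p := p) 4 2 256 rfl (by norm_num)
  have e5 := cast_sum_eq (p := p) 5 3 1024 rfl (by norm_num)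
  rw [show ((-1 : ℚ) ^ 1) = -1 by norm_num] at e3
  rw [show ((-1 : ℚ) ^ 3) = -1 by norm_num] at e5
  simp only [show ((-1 : ℚ) ^ 2) = 1 by norm_num, one_pow, mul_one] at e4
  simp only [Nat.cast_ofNat] at e3 e4 e5
  refine ⟨?_, ?_, fun h => ?_, fun h => ?_⟩
  · rw [e3]
    refine (harmonic_sum_modEq_one hn).trans ((((four_pow_pow_modEq hn 3).const_mul
      ((isInt_ofNat 2).mul (isInt_one.neg.pow n)))|>.trans (.of_eq ?_)) |> fun h =>
        (PadicModEq.of_eq (by ring)).trans h)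
    rw [show (p - 1) / 2 = n by omega]
    push_cast; ring
  · rw [e4]
    refine (harmonic_sum_modEq_two hn).trans (((four_pow_pow_modEq hn 6).const_mul
      (isInt_ofNat 2)).trans (.of_eq ?_))
    push_cast; ring
  · obtain ⟨m, rfl⟩ : ∃ m, n = 2 * m := ⟨n / 2, by omega⟩
    have t4 : IsInt (1 / 4 : ℚ_[p]) := isInt_div_twelve hn hp 3 (by norm_num)
    have u1 := isPUnit_poch_one_add (p := p) t4.neg (k := m) (by omega)
    have hw := isPUnit_poch_one (p := p) (k := 2 * (2 * m)) (by omega)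
    rw [e5]
    have h1 := harmonic_sum_modEq_three hn hp
      (((hg.pow 2).mul hw).isInt.div (u1.pow 4)) (dixonQuot_modEq hn hp)
    -- Of the five factors 4^n, three come from `halfQuot_modEq` and two from the Dixon value;
    -- together they give 10 p q_p(2). The sign (-1)^n is 1 because n = 2m, and the minus sign of
    -- the result comes from Γ_p(1/4)⁴.
    have h2 := ((four_pow_pow_modEq hn 5).const_mul (isInt_ofNat 2)).symm
    have h3 := h2.mul_of_isInt (padicGamma_quarter_pow_modEq hn hp)
      ((isInt_ofNat 2).mul (hg.isInt.pow 5)) (hw.isInt.div (u1.pow 4)).neg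
    refine h1.trans ((PadicModEq.of_eq ?_).trans (h3.neg.symm.trans (.of_eq ?_)))
    · rw [pow_mul (-1 : ℚ_[p]) 2 m]
      simp only [neg_one_sq, one_pow, div_eq_mul_inv]
      ring
    · push_cast; ring
  · obtain ⟨m, rfl⟩ : ∃ m, n = 2 * m + 1 := ⟨n / 2, by omega⟩
    rw [e5]
    have h1 := harmonic_sum_modEq_three hn hp isInt_zero
      (dixonQuot_modEq_zero (m := m) (by omega) hp)
    exact h1.trans (.of_eq (by ring))

end Main
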